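/- Let $d\ge 2$ be an integer. For an integer $n\ge 0$ let $p_d(n)$ be the number of lower sets of size $n$ in $\mathbb Z_+^d=\{0,1,2,\dots\}^d$, i.e. of sets $Q\subset\mathbb Z_+^d$ with $|Q|=n$ such that $k\in Q$, $k'\in\mathbb Z_+^d$ and $k_i'\le k_i$ for all $i$ imply $k'\in Q$. Put $$\lambda_d=\frac{d}{(d!)^{1/d}},\qquad \alpha_2=\pi\sqrt{2/3},\qquad \rho_d=\frac{d}{d-1}\bigl[(d-1)\zeta(d)\bigr]^{1/d},$$ where $\zeta$ is the Riemann zeta function. Then: (a) for all $n\ge 2$, $$\Bigl(1-\min\bigl\{\tfrac{d}{d+1},\,e\,n^{-1/d}\bigr\}\Bigr)^2\lambda_d\ln 2\;\le\;\frac{\ln p_d(n)}{n^{1-1/d}}\;\le\;\alpha_2\,d^{\ln d};$$ (b) $p_d(n)\le\gamma_d^{\,n^{1-1/d}}$ for all $n\ge 0$, where $\gamma_d=e^{\alpha_2 d^{\ln d}}$; (c) $$\lambda_d\ln 2\;<\;\liminf_{n\to\infty}\frac{\ln p_d(n)}{n^{1-1/d}}\;\le\;\limsup_{n\to\infty}\frac{\ln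 p_d(n)}{n^{1-1/d}}\;<\;\alpha_2\,d^{\ln d};$$ (d) if $d\ge 8$, then $\liminf_{n\to\infty}\frac{\ln p_d(n)}{n^{1-1/d}}>\rho_d$; in particular, $\frac{\ln p_d(n)}{n^{1-1/d}}$ does not converge to $\rho_d$ as $n\to\infty$ (the conjectured value of its limit). -/

import Mathlib

namespace LowerSetCount

/-- The lower sets `Q ⊆ ℤ₊^d` with exactly `n` points: finite sets of points with non-negative
integer coordinates that contain, with a point `k`, every point `k' ≤ k` (coordinatewise). -/
def lowerSets (d n : ℕ) : Set (Finset (Fin d → ℕ)) :=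
  {Q | IsLowerSet (Q : Set (Fin d → ℕ)) ∧ Q.card = n}

/-- There are only finitely many lower sets of a given size, so that counting them by
`Set.ncard` is meaningful. -/
theorem lowerSets_finite (d n : ℕ) : (lowerSets d n).Finite := by
  refine (Finset.finite_toSet (Fintype.piFinset fun _ : Fin d => Finset.range n).powerset).subset ?_
  rintro Q ⟨hQ, hcard⟩
  rw [Finset.mem_coe, Finset.mem_powerset]
  intro k hk
  rw [Fintype.mem_piFinset]
  intro i
  rw [Finset.mem_range]
  by_contra hi
  push Not at hi
  have hsub : (Finset.range (n + 1)).image (fun j => Function.update k i j) ⊆ Q := by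
    intro x hx
    obtain ⟨j, hj, rfl⟩ := Finset.mem_image.1 hx
    have hj' : j ≤ k i := le_trans (Nat.lt_succ_iff.1 (Finset.mem_range.1 hj)) hi
    exact hQ (update_le_self_iff.2 hj') hk
  have h := Finset.card_le_card hsub
  rw [Finset.card_image_of_injective _ (Function.update_injective k i), Finset.card_range,
    hcard] at h
  omega

/-- `p_d(n)`, the number of lower sets of size `n` in `ℤ₊^d`. -/
noncomputable def p (d n : ℕ) : ℕ := (lowerSets d n).ncard

/-- `ln p_d(n) / n^(1 - 1/d)`. -/
noncomputable def growth (d n : ℕ) : ℝ :=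
  Real.log (p d n : ℝ) / (n : ℝ) ^ (1 - 1 / (d : ℝ))

/-- `λ_d = d / (d!)^(1/d)`. -/
noncomputable def lam (d : ℕ) : ℝ :=
  (d : ℝ) / (Nat.factorial d : ℝ) ^ (1 / (d : ℝ))

/-- `C'_{d,n} = (1 - min {d/(d+1), e n^(-1/d)})² λ_d ln 2`. -/
noncomputable def lowerConst (d n : ℕ) : ℝ :=
  (1 - min ((d : ℝ) / ((d : ℝ) + 1)) (Real.exp 1 * (n : ℝ) ^ (-(1 / (d : ℝ))))) ^ 2
    * lam d * Real.log 2

/-- `α_2 = π √(2/3)`. -/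
noncomputable def alphaTwo : ℝ := Real.pi * Real.sqrt (2 / 3)

/-- `C_d = α_2 d^(ln d)`. -/
noncomputable def upperConst (d : ℕ) : ℝ := alphaTwo * (d : ℝ) ^ Real.log (d : ℝ)

/-- `γ_d = exp (α_2 d^(ln d))`. -/
noncomputable def gam (d : ℕ) : ℝ := Real.exp (alphaTwo * (d : ℝ) ^ Real.log (d : ℝ))

/-- The conjectured value `ρ_d = d/(d-1) · [(d-1) ζ(d)]^(1/d)` of the limit of `growth d`.
(`ζ(d)` is real for an integer `d ≥ 2`.) -/
noncomputable def rho (d : ℕ) : ℝ :=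
  (d : ℝ) / ((d : ℝ) - 1) *
    (((d : ℝ) - 1) * (riemannZeta (d : ℂ)).re) ^ (1 / (d : ℝ))

/-- The lower growth rate `liminf_{n → ∞} ln p_d(n) / n^(1 - 1/d)`, as an extended real. -/
noncomputable def alphaInf (d : ℕ) : EReal :=
  Filter.liminf (fun n : ℕ => ((growth d n : ℝ) : EReal)) Filter.atTop

/-- The upper growth rate `limsup_{n → ∞} ln p_d(n) / n^(1 - 1/d)`, as an extended real. -/
noncomputable def alphaSup (d : ℕ) : EReal :=
  Filter.limsup (fun n : ℕ => ((growth d n : ℝ) : EReal)) Filter.atTop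

end LowerSetCount

/-! Upper bound. Let `n = y^d` and `m = ⌊y⌋`. A lower set of size `n` cannot contain the cube of
side `m + 1`, so each of its points has some coordinate below `m`, and one of the `d` slabs of width
`m` holds at least `n/d` of the points. Cutting off that slab leaves `m` slices, which are lower
sets in dimension `d - 1`, and a translated smaller lower set in dimension `d` (`p_succ_le`). In the
resulting recursion, `p_d` of the remainder is bounded by strong induction on `n` and the tangent
line of the concave power `x^(1-1/d)`. The exponent is then linear in the sizes of the slices, so
the sum factors into the `m`-th power of a generating function in dimension `d - 1`
(`p_succ_le_exp`). For `d = 2`, Euler's product for partitions gives the constant `α_2`; `d = 3`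
uses that product once more; from `d = 4` on, the constant `0.98 α_2 d^(ln d)` is inductive, since
the growth of `d^(ln d)` outweighs the loss per dimension (`log_gain`). For small `n` the estimate
`p_d(n) ≤ d^n` suffices.

Lower bound. The points with coordinate sum below `r`, together with any set of points with sum
exactly `r`, form a lower set. If the vertex on the first axis is kept, the set can be prolonged
along that axis to any larger size, so the size `n` is hit exactly. This yields one bit per point of
the layer except the vertex (`two_pow_le_p`), which is (a) after comparing binomials with `(d!
n)^(1/d)`.

For the strict inequality a second layer is used: under a random subset of layer `r`, a point of
layer `r + 1` has all its lower neighbours present with probability at least `2^(-d)`, and may then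
be added or not. Jensen's inequality improves the rate by a fixed factor (`two_rpow_le_p`). Finally
`ρ_d ≤ λ_d ln 2` for `d ≥ 8`, so the conjectured limit lies below the lower growth rate. -/

open Finset Filter

namespace LowerSetCount

/-! ### Lower sets, their slices and tails -/

/-- The finset of all lower sets with `n` points in dimension `d`. -/
noncomputable def lowerFinset (d n : ℕ) : Finset (Finset (Fin d → ℕ)) :=
  (lowerSets_finite d n).toFinset

lemma mem_lowerFinset {d n : ℕ} {Q : Finset (Fin d → ℕ)} :
    Q ∈ lowerFinset d n ↔ IsLowerSet (Q : Set (Fin d → ℕ)) ∧ Q.card = n := by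
  simp [lowerFinset, lowerSets]

lemma card_lowerFinset (d n : ℕ) : (lowerFinset d n).card = p d n :=
  (Set.ncard_eq_toFinset_card _ _).symm

lemma p_zero_right (d : ℕ) : p d 0 = 1 := by
  rw [← card_lowerFinset, Finset.card_eq_one]
  refine ⟨∅, ?_⟩
  ext Q
  rw [mem_lowerFinset, Finset.card_eq_zero, Finset.mem_singleton]
  constructor
  · exact fun h => h.2
  · rintro rfl
    simp [isLowerSet_empty]

lemma p_zero_left (n : ℕ) (hn : 2 ≤ n) : p 0 n = 0 := by
  rw [← card_lowerFinset, Finset.card_eq_zero, Finset.eq_empty_iff_forall_notMem]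
  intro Q hQ
  have h := (mem_lowerFinset.1 hQ).2
  have := Finset.card_le_one_of_subsingleton Q
  omega

lemma p_le_one_zero_left (n : ℕ) : p 0 n ≤ 1 := by
  rw [← card_lowerFinset, Finset.card_le_one]
  intro A hA B hB
  have hA := (mem_lowerFinset.1 hA).2
  have hB := (mem_lowerFinset.1 hB).2
  rcases n with _ | n
  · rw [Finset.card_eq_zero] at hA hB
    rw [hA, hB]
  · have hA' := Finset.card_pos.1 (by omega : 0 < A.card)
    have hB' := Finset.card_pos.1 (by omega : 0 < B.card)
    obtain ⟨x, hx⟩ := hA'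
    obtain ⟨y, hy⟩ := hB'
    ext z
    rw [Subsingleton.elim x z] at hx
    rw [Subsingleton.elim y z] at hy
    simp [hx, hy]

variable {e : ℕ}

lemma insertNth_injective (i : Fin (e + 1)) (j : ℕ) :
    Function.Injective fun x : Fin e → ℕ => (i.insertNth j x : Fin (e + 1) → ℕ) := by
  intro x y h
  simpa using congrArg i.removeNth h

lemma single_le_of_le {d : ℕ} {i : Fin d} {m : ℕ} {k : Fin d → ℕ} (h : m ≤ k i) :
    Pi.single i m ≤ k := by
  intro l
  by_cases hl : l = i
  · subst hl
    simpa using h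
  · simp [hl]

/-- The points of `Q` with `i`-th coordinate `j`, as a set in one dimension less. -/
noncomputable def slice (i : Fin (e + 1)) (j : ℕ) (Q : Finset (Fin (e + 1) → ℕ)) :
    Finset (Fin e → ℕ) :=
  Q.preimage (fun x => i.insertNth j x) (insertNth_injective i j).injOn

/-- The points of `Q` with `i`-th coordinate at least `m`, translated by `m` along axis `i`. -/
noncomputable def tail (i : Fin (e + 1)) (m : ℕ) (Q : Finset (Fin (e + 1) → ℕ)) :
    Finset (Fin (e + 1) → ℕ) :=
  Q.preimage (fun k => k + Pi.single i m) (add_left_injective _).injOn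

lemma mem_slice {i : Fin (e + 1)} {j : ℕ} {Q : Finset (Fin (e + 1) → ℕ)} {x : Fin e → ℕ} :
    x ∈ slice i j Q ↔ (i.insertNth j x : Fin (e + 1) → ℕ) ∈ Q := by
  simp [slice]

lemma mem_tail {i : Fin (e + 1)} {m : ℕ} {Q : Finset (Fin (e + 1) → ℕ)} {k : Fin (e + 1) → ℕ} :
    k ∈ tail i m Q ↔ k + Pi.single i m ∈ Q := by
  simp [tail]

lemma isLowerSet_slice {Q : Finset (Fin (e + 1) → ℕ)}
    (hQ : IsLowerSet (Q : Set (Fin (e + 1) → ℕ))) (i : Fin (e + 1)) (j : ℕ) :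
    IsLowerSet (slice i j Q : Set (Fin e → ℕ)) := by
  intro x y hyx hx
  rw [Finset.mem_coe, mem_slice] at hx ⊢
  refine hQ ?_ hx
  rw [Fin.insertNth_le_iff]
  simpa using hyx

lemma isLowerSet_tail {Q : Finset (Fin (e + 1) → ℕ)}
    (hQ : IsLowerSet (Q : Set (Fin (e + 1) → ℕ))) (i : Fin (e + 1)) (m : ℕ) :
    IsLowerSet (tail i m Q : Set (Fin (e + 1) → ℕ)) := by
  intro x y hyx hx
  rw [Finset.mem_coe, mem_tail] at hx ⊢
  exact hQ (add_le_add_left hyx _) hx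

lemma card_slice (i : Fin (e + 1)) (j : ℕ) (Q : Finset (Fin (e + 1) → ℕ)) :
    (slice i j Q).card = (Q.filter fun k => k i = j).card := by
  classical
  rw [slice, Finset.card_preimage]
  congr 1
  refine Finset.filter_congr fun k _ => ?_
  constructor
  · rintro ⟨x, rfl⟩
    simp
  · rintro rfl
    exact ⟨i.removeNth k, Fin.insertNth_self_removeNth i k⟩

lemma card_tail (i : Fin (e + 1)) (m : ℕ) (Q : Finset (Fin (e + 1) → ℕ)) :
    (tail i m Q).card = (Q.filter fun k => m ≤ k i).card := by
  classical
  rw [tail, Finset.card_preimage]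
  congr 1
  refine Finset.filter_congr fun k _ => ?_
  constructor
  · rintro ⟨x, rfl⟩
    simp
  · intro h
    refine ⟨k - Pi.single i m, tsub_add_cancel_of_le (single_le_of_le h)⟩

lemma sum_card_slice (i : Fin (e + 1)) (m : ℕ) (Q : Finset (Fin (e + 1) → ℕ)) :
    ∑ j : Fin m, (slice i j Q).card = (Q.filter fun k => k i < m).card := by
  rw [Fin.sum_univ_eq_sum_range (fun j => (slice i j Q).card),
    Finset.card_eq_sum_card_fiberwise (f := fun k => k i) (t := Finset.range m)]
  · refine Finset.sum_congr rfl fun j hj => ?_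
    rw [card_slice, Finset.filter_filter]
    congr 1
    refine Finset.filter_congr fun k _ => ?_
    have := Finset.mem_range.1 hj
    omega
  · intro k hk
    simpa using (Finset.mem_filter.1 hk).2

lemma sum_card_slice_add_card_tail (i : Fin (e + 1)) (m : ℕ) (Q : Finset (Fin (e + 1) → ℕ)) :
    ∑ j : Fin m, (slice i j Q).card + (tail i m Q).card = Q.card := by
  rw [sum_card_slice, card_tail]
  simp only [← not_lt]
  exact Finset.card_filter_add_card_filter_not _

lemma eq_of_slice_eq_of_tail_eq {i : Fin (e + 1)} {m : ℕ} {Q Q' : Finset (Fin (e + 1) → ℕ)}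
    (hs : ∀ j : Fin m, slice i j Q = slice i j Q') (ht : tail i m Q = tail i m Q') : Q = Q' := by
  ext k
  rcases lt_or_ge (k i) m with h | h
  · have := congrArg (fun A => i.removeNth k ∈ A) (hs ⟨k i, h⟩)
    simpa [mem_slice] using this
  · have := congrArg (fun A => (k - Pi.single i m) ∈ A) ht
    have hle : Pi.single i m ≤ k := single_le_of_le h
    simpa [mem_tail, tsub_add_cancel_of_le hle] using this

/-! ### The slab recursion and the trivial exponential bound -/

/-- Counting lower sets by the sizes of their first `m` slices along axis `i`. -/
lemma card_filter_slab_le (i : Fin (e + 1)) (m n : ℕ) (P : ℕ → Prop) [DecidablePred P] :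
    ((lowerFinset (e + 1) n).filter fun Q => P (∑ j : Fin m, (slice i j Q).card)).card ≤
      ∑ s ∈ (Fintype.piFinset fun _ : Fin m => Finset.range (n + 1)).filter
          fun s => P (∑ j, s j) ∧ ∑ j, s j ≤ n,
        (∏ j, p e (s j)) * p (e + 1) (n - ∑ j, s j) := by
  rw [Finset.card_eq_sum_card_fiberwise (f := fun Q (j : Fin m) => (slice i j Q).card)
    (t := (Fintype.piFinset fun _ : Fin m => Finset.range (n + 1)).filter
          fun s => P (∑ j, s j) ∧ ∑ j, s j ≤ n)]
  · refine Finset.sum_le_sum fun s _ => ?_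
    simp_rw [← card_lowerFinset]
    rw [← Fintype.card_piFinset, ← Finset.card_product]
    refine Finset.card_le_card_of_injOn (fun Q => (fun j => slice i j Q, tail i m Q)) ?_ ?_
    · intro Q hQ
      simp only [Finset.coe_filter, Set.mem_ofPred_eq, Finset.mem_filter] at hQ
      obtain ⟨⟨hQ, -⟩, rfl⟩ := hQ
      obtain ⟨hl, hc⟩ := mem_lowerFinset.1 hQ
      have := sum_card_slice_add_card_tail i m Q
      rw [Finset.mem_coe, Finset.mem_product, Fintype.mem_piFinset]
      refine ⟨fun j => mem_lowerFinset.2 ⟨isLowerSet_slice hl _ _, rfl⟩,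
        mem_lowerFinset.2 ⟨isLowerSet_tail hl _ _, ?_⟩⟩
      simp only
      omega
    · intro Q _ Q' _ h
      simp only [Prod.mk.injEq] at h
      exact eq_of_slice_eq_of_tail_eq (fun j => congrFun h.1 j) h.2
  · intro Q hQ
    simp only [Finset.coe_filter, Set.mem_ofPred_eq] at hQ ⊢
    have hc := (mem_lowerFinset.1 hQ.1).2
    have := sum_card_slice_add_card_tail i m Q
    refine ⟨?_, hQ.2, by omega⟩
    rw [Fintype.mem_piFinset]
    intro j
    rw [Finset.mem_range, card_slice, ← hc]
    exact Nat.lt_succ_of_le (Finset.card_filter_le _ _)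

/-- A lower set with fewer than `(m + 1) ^ d` points has a `d`-th of its points in a slab of
width `m`. -/
lemma exists_card_le_slab {d m : ℕ} {Q : Finset (Fin d → ℕ)}
    (hQ : IsLowerSet (Q : Set (Fin d → ℕ))) (hd : 0 < d) (hm : Q.card < (m + 1) ^ d) :
    ∃ i, Q.card ≤ d * (Q.filter fun k => k i < m).card := by
  by_contra! h
  -- A point with all coordinates at least `m` would force the whole cube of `(m + 1)^d` points into
  -- `Q`.
  have hcover : Q ⊆ Finset.univ.biUnion fun i => Q.filter fun k => k i < m := by
    intro k hk
    by_contra hk'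
    simp only [Finset.mem_biUnion, Finset.mem_univ, true_and, Finset.mem_filter, not_exists,
      not_lt, hk] at hk'
    have hsub : (Fintype.piFinset fun _ : Fin d => Finset.range (m + 1)) ⊆ Q := by
      intro x hx
      rw [Fintype.mem_piFinset] at hx
      refine hQ ?_ hk
      intro i
      have := Finset.mem_range.1 (hx i)
      exact (Nat.lt_succ_iff.1 this).trans (hk' i)
    have := Finset.card_le_card hsub
    simp at this
    omega
  have h1 := (Finset.card_le_card hcover).trans Finset.card_biUnion_le
  have h2 : d * Q.card ≤ ∑ i : Fin d, d * (Q.filter fun k => k i < m).card := by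
    rw [← Finset.mul_sum]
    exact Nat.mul_le_mul_left _ h1
  have h3 : ∑ i : Fin d, d * (Q.filter fun k => k i < m).card < ∑ i : Fin d, Q.card :=
    Finset.sum_lt_sum_of_nonempty ⟨⟨0, hd⟩, Finset.mem_univ _⟩ fun i _ => h i
  simp at h3
  omega

/-- The slab bound does not depend on the axis, so the union over the possible heavy axes costs only
the factor `e + 1`. -/
lemma p_succ_le (m n : ℕ) (hm : n < (m + 1) ^ (e + 1)) :
    p (e + 1) n ≤ (e + 1) *
      ∑ s ∈ (Fintype.piFinset fun _ : Fin m => Finset.range (n + 1)).filter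
          fun s => n ≤ (e + 1) * ∑ j, s j ∧ ∑ j, s j ≤ n,
        (∏ j, p e (s j)) * p (e + 1) (n - ∑ j, s j) := by
  rw [← card_lowerFinset]
  have hcover : lowerFinset (e + 1) n ⊆ Finset.univ.biUnion fun i : Fin (e + 1) =>
      (lowerFinset (e + 1) n).filter fun Q => n ≤ (e + 1) * (∑ j : Fin m, (slice i j Q).card) := by
    intro Q hQ
    obtain ⟨hl, hc⟩ := mem_lowerFinset.1 hQ
    obtain ⟨i, hi⟩ := exists_card_le_slab hl (Nat.succ_pos e) (by rw [hc]; exact hm)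
    rw [Finset.mem_biUnion]
    refine ⟨i, Finset.mem_univ _, Finset.mem_filter.2 ⟨hQ, ?_⟩⟩
    rwa [sum_card_slice, ← hc]
  refine (Finset.card_le_card hcover).trans (Finset.card_biUnion_le.trans ?_)
  refine (Finset.sum_le_sum fun i _ =>
    card_filter_slab_le i m n fun N => n ≤ (e + 1) * N).trans ?_
  simp

/-- The bottom slice of a nonempty lower set is nonempty. Removing it gives a convolution, which the
two inductions bound by the geometric sum `∑ e^k (e+1)^(n-1-k) + e^n = (e+1)^n`. -/
lemma p_le_pow (d n : ℕ) : p d (n + 1) ≤ d ^ n := by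
  induction d generalizing n with
  | zero =>
    rcases n with _ | n
    · simpa using p_le_one_zero_left 1
    · simp [p_zero_left]
  | succ e ih =>
    induction n using Nat.strong_induction_on with
    | _ n ihn =>
    have h := card_filter_slab_le (0 : Fin (e + 1)) 1 (n + 1) fun N => 1 ≤ N
    have hall : ((lowerFinset (e + 1) (n + 1)).filter fun Q =>
        1 ≤ ∑ j : Fin 1, (slice (0 : Fin (e + 1)) j Q).card) = lowerFinset (e + 1) (n + 1) := by
      refine Finset.filter_true_of_mem fun Q hQ => ?_
      obtain ⟨hl, hc⟩ := mem_lowerFinset.1 hQ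
      rw [sum_card_slice, Nat.one_le_iff_ne_zero, Finset.card_ne_zero]
      obtain ⟨k, hk⟩ := Finset.card_pos.1 (by omega : 0 < Q.card)
      exact ⟨0, Finset.mem_filter.2 ⟨hl (zero_le : (0 : Fin (e + 1) → ℕ) ≤ k) hk, by simp⟩⟩
    rw [hall, card_lowerFinset] at h
    have hsum : ∑ s ∈ (Fintype.piFinset fun _ : Fin 1 => Finset.range (n + 1 + 1)).filter
          fun s => 1 ≤ ∑ j, s j ∧ ∑ j, s j ≤ n + 1,
        (∏ j, p e (s j)) * p (e + 1) (n + 1 - ∑ j, s j) ≤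
        ∑ k ∈ Finset.range (n + 1), p e (k + 1) * p (e + 1) (n - k) := by
      refine le_of_eq ?_
      refine Finset.sum_bij' (fun s _ => s 0 - 1) (fun k _ _ => k + 1) ?_ ?_ ?_ ?_ ?_
      · intro s hs
        simp at hs ⊢
        omega
      · intro k hk
        simp at hk ⊢
        omega
      · intro s hs
        simp at hs
        funext j
        rw [Subsingleton.elim j 0]
        omega
      · intro k hk
        simp
      · intro s hs
        simp at hs
        simp only [Fin.isValue, univ_unique, Fin.default_eq_zero, prod_singleton, sum_singleton]
        congr 2 <;> omega
    refine h.trans (hsum.trans ?_)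
    rw [Finset.sum_range_succ, Nat.sub_self, p_zero_right, mul_one]
    have hg := geom_sum₂_mul_add (1 : ℕ) e n
    rw [Nat.add_comm 1 e, mul_one] at hg
    rw [← hg]
    refine Nat.add_le_add ?_ (ih n)
    rw [← Finset.sum_range_reflect]
    refine Finset.sum_le_sum fun k hk => ?_
    have hk := Finset.mem_range.1 hk
    have h1 := ih (n - 1 - k)
    have h2 := ihn k hk
    rw [show n - (n - 1 - k) = k + 1 by omega, mul_comm]
    exact Nat.mul_le_mul h2 h1

lemma lt_card_of_mem {d : ℕ} {Q : Finset (Fin d → ℕ)}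
    (hQ : IsLowerSet (Q : Set (Fin d → ℕ))) {k : Fin d → ℕ} (hk : k ∈ Q) (i : Fin d) :
    k i < Q.card := by
  have hsub : (Finset.range (k i + 1)).image (fun j => Function.update k i j) ⊆ Q := by
    intro x hx
    obtain ⟨j, hj, rfl⟩ := Finset.mem_image.1 hx
    exact hQ (update_le_self_iff.2 (Nat.lt_succ_iff.1 (Finset.mem_range.1 hj))) hk
  have h := Finset.card_le_card hsub
  rw [Finset.card_image_of_injective _ (Function.update_injective k i), Finset.card_range] at h
  omega

/-! ### Dimension two: partitions and Euler's product -/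

/-- The planar lower sets with `n` points and all abscissas less than `w`. -/
noncomputable def narrow (w n : ℕ) : Finset (Finset (Fin 2 → ℕ)) :=
  (lowerFinset 2 n).filter fun Q => ∀ k ∈ Q, k 0 < w

lemma mem_narrow {w n : ℕ} {Q : Finset (Fin 2 → ℕ)} :
    Q ∈ narrow w n ↔ (IsLowerSet (Q : Set (Fin 2 → ℕ)) ∧ Q.card = n) ∧ ∀ k ∈ Q, k 0 < w := by
  rw [narrow, Finset.mem_filter, mem_lowerFinset]

lemma narrow_self (n : ℕ) {w : ℕ} (hw : n ≤ w) : (narrow w n).card = p 2 n := by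
  rw [← card_lowerFinset, narrow, Finset.filter_true_of_mem]
  intro Q hQ k hk
  obtain ⟨hl, rfl⟩ := mem_lowerFinset.1 hQ
  exact (lt_card_of_mem hl hk 0).trans_le hw

lemma card_narrow_zero (n : ℕ) : (narrow 0 n).card ≤ if n = 0 then 1 else 0 := by
  have h0 : ∀ Q ∈ narrow 0 n, Q = ∅ := by
    intro Q hQ
    rw [Finset.eq_empty_iff_forall_notMem]
    exact fun k hk => Nat.not_lt_zero _ ((mem_narrow.1 hQ).2 k hk)
  split_ifs with hn
  · rw [Finset.card_le_one]
    intro A hA B hB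
    rw [h0 A hA, h0 B hB]
  · rw [Nat.le_zero, Finset.card_eq_zero, Finset.eq_empty_iff_forall_notMem]
    intro Q hQ
    have h1 := (mem_narrow.1 hQ).1.2
    rw [h0 Q hQ, Finset.card_empty] at h1
    omega

lemma slice_eq_of_width {Q : Finset (Fin 2 → ℕ)} (hQ : IsLowerSet (Q : Set (Fin 2 → ℕ)))
    {w : ℕ} (hw : ∀ k ∈ Q, k 0 < w + 1) {k : Fin 2 → ℕ} (hk : k ∈ Q) (hkw : w ≤ k 0) :
    slice (e := 1) 1 0 Q = (Finset.range (w + 1)).image fun j _ => j := by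
  ext x
  rw [mem_slice, Finset.mem_image]
  have h0 : (Fin.insertNth (1 : Fin (1 + 1)) 0 x : Fin 2 → ℕ) 0 = x 0 :=
    Fin.insertNth_apply_succAbove (α := fun _ => ℕ) (1 : Fin (1 + 1)) (0 : ℕ) x 0
  have h1 : (Fin.insertNth (1 : Fin (1 + 1)) 0 x : Fin 2 → ℕ) 1 = 0 :=
    Fin.insertNth_apply_same (α := fun _ => ℕ) (1 : Fin (1 + 1)) (0 : ℕ) x
  constructor
  · intro h
    refine ⟨x 0, Finset.mem_range.2 (h0 ▸ hw _ h), ?_⟩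
    funext j
    rw [Subsingleton.elim j 0]
  · rintro ⟨j, hj, rfl⟩
    refine hQ ?_ hk
    intro l
    have hj := Finset.mem_range.1 hj
    fin_cases l
    · have hjk : j ≤ k 0 := by omega
      exact h0.le.trans hjk
    · exact h1.le.trans (Nat.zero_le _)

/-- The recursion for partitions into parts of size at most `w + 1`: if some abscissa equals `w`,
the bottom row consists of exactly `w + 1` points, so it carries no information and can be removed.
-/
lemma card_narrow_succ_le (w n : ℕ) :
    (narrow (w + 1) n).card ≤
      (narrow w n).card + if w + 1 ≤ n then (narrow (w + 1) (n - (w + 1))).card else 0 := by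
  rw [← Finset.card_filter_add_card_filter_not (s := narrow (w + 1) n)
    (fun Q => ∀ k ∈ Q, k 0 < w)]
  refine Nat.add_le_add (Finset.card_le_card ?_) ?_
  · intro Q hQ
    rw [Finset.mem_filter, mem_narrow] at hQ
    exact mem_narrow.2 ⟨hQ.1.1, hQ.2⟩
  have hslice : ∀ Q ∈ (narrow (w + 1) n).filter (fun Q => ¬ ∀ k ∈ Q, k 0 < w),
      slice (e := 1) 1 0 Q = (Finset.range (w + 1)).image fun j _ => j := by
    intro Q hQ
    rw [Finset.mem_filter, mem_narrow] at hQ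
    obtain ⟨⟨⟨hl, -⟩, hw⟩, hex⟩ := hQ
    push Not at hex
    obtain ⟨k, hk, hkw⟩ := hex
    exact slice_eq_of_width hl hw hk hkw
  have hcard : ∀ Q ∈ (narrow (w + 1) n).filter (fun Q => ¬ ∀ k ∈ Q, k 0 < w),
      (w + 1) + (tail (e := 1) 1 1 Q).card = n := by
    intro Q hQ
    have h1 := sum_card_slice_add_card_tail (e := 1) 1 1 Q
    rw [Finset.mem_filter, mem_narrow] at hQ
    rw [hQ.1.1.2, Fin.sum_univ_one, Fin.val_zero,
      hslice Q (by rw [Finset.mem_filter, mem_narrow]; exact hQ),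
      Finset.card_image_of_injective _ (fun a b h => congrFun h 0), Finset.card_range] at h1
    exact h1
  split_ifs with hn
  · refine Finset.card_le_card_of_injOn (fun Q => tail (e := 1) 1 1 Q) ?_ ?_
    · intro Q hQ
      have h1 := hcard Q hQ
      rw [Finset.mem_coe, Finset.mem_filter, mem_narrow] at hQ
      rw [Finset.mem_coe, mem_narrow]
      refine ⟨⟨isLowerSet_tail hQ.1.1.1 _ _, (Nat.sub_eq_of_eq_add' h1.symm).symm⟩, fun k hk => ?_⟩
      rw [mem_tail] at hk
      simpa using hQ.1.2 _ hk
    · intro Q hQ Q' hQ' h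
      refine eq_of_slice_eq_of_tail_eq (i := 1) (m := 1) (fun j => ?_) h
      rw [Subsingleton.elim j 0, Fin.val_zero, hslice Q hQ, hslice Q' hQ']
  · rw [Nat.le_zero, Finset.card_eq_zero, Finset.eq_empty_iff_forall_notMem]
    intro Q hQ
    have := hcard Q hQ
    omega

/-- The recursion reads `G_(w+1) ≤ G_w + q^(w+1) G_(w+1)`. It holds for truncated sums because the
shift only drops nonnegative terms, so no convergence is needed. -/
lemma sum_narrow_le {q : ℝ} (hq0 : 0 < q) (hq1 : q < 1) (w N : ℕ) :
    ∑ n ∈ Finset.range N, ((narrow w n).card : ℝ) * q ^ n ≤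
      ∏ j ∈ Finset.range w, (1 - q ^ (j + 1))⁻¹ := by
  induction w with
  | zero =>
    rw [Finset.prod_range_zero]
    calc ∑ n ∈ Finset.range N, ((narrow 0 n).card : ℝ) * q ^ n
        ≤ ∑ n ∈ Finset.range N, if n = 0 then (1 : ℝ) else 0 := by
          refine Finset.sum_le_sum fun n _ => ?_
          have h := card_narrow_zero n
          split_ifs at h ⊢ with hn
          · subst hn
            simpa using h
          · simp [Nat.le_zero.1 h]
      _ ≤ 1 := by
          rw [Finset.sum_ite_eq']
          split_ifs <;> norm_num
  | succ w ih =>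
    have hlt : q ^ (w + 1) < 1 := pow_lt_one₀ hq0.le hq1 (Nat.succ_ne_zero w)
    rw [Finset.prod_range_succ, ← div_eq_mul_inv, le_div_iff₀ (by linarith)]
    have hshift : ∑ n ∈ Finset.range N, ((if w + 1 ≤ n then (narrow (w + 1) (n - (w + 1))).card
        else 0 : ℕ) : ℝ) * q ^ n ≤
        q ^ (w + 1) * ∑ n ∈ Finset.range N, ((narrow (w + 1) n).card : ℝ) * q ^ n := by
      calc _ = ∑ n ∈ (Finset.range N).filter (fun n => w + 1 ≤ n),
            ((narrow (w + 1) (n - (w + 1))).card : ℝ) * q ^ n := by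
            rw [Finset.sum_filter]
            refine Finset.sum_congr rfl fun n _ => ?_
            split_ifs <;> simp
        _ = ∑ n ∈ Finset.Ico (w + 1) N,
            ((narrow (w + 1) (n - (w + 1))).card : ℝ) * q ^ n := by
            congr 1
            ext n
            simp [and_comm]
        _ = ∑ n ∈ Finset.range (N - (w + 1)),
            q ^ (w + 1) * (((narrow (w + 1) n).card : ℝ) * q ^ n) := by
            rw [Finset.sum_Ico_eq_sum_range]
            refine Finset.sum_congr rfl fun n _ => ?_
            rw [Nat.add_sub_cancel_left, pow_add]
            ring
        _ ≤ _ := by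
            rw [Finset.mul_sum]
            refine Finset.sum_le_sum_of_subset_of_nonneg ?_ fun n _ _ => by positivity
            exact Finset.range_subset_range.2 (Nat.sub_le _ _)
    have hrec : ∑ n ∈ Finset.range N, ((narrow (w + 1) n).card : ℝ) * q ^ n ≤
        ∑ n ∈ Finset.range N, ((narrow w n).card : ℝ) * q ^ n +
        ∑ n ∈ Finset.range N, ((if w + 1 ≤ n then (narrow (w + 1) (n - (w + 1))).card
        else 0 : ℕ) : ℝ) * q ^ n := by
      rw [← Finset.sum_add_distrib]
      refine Finset.sum_le_sum fun n _ => ?_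
      rw [← add_mul]
      refine mul_le_mul_of_nonneg_right ?_ (by positivity)
      exact_mod_cast card_narrow_succ_le w n
    linarith

lemma sum_range_pow_le {u : ℝ} (hu : 0 < u) (N : ℕ) :
    ∑ j ∈ Finset.range N, Real.exp (-u) ^ (j + 1) ≤ 1 / u := by
  have h0 : 0 < Real.exp (-u) := Real.exp_pos _
  have h1 : Real.exp (-u) < 1 := by
    rw [Real.exp_lt_one_iff]
    linarith
  have hs := (hasSum_geometric_of_lt_one h0.le h1).mul_left (Real.exp (-u))
  have hle := sum_le_hasSum (Finset.range N) (fun j _ => by positivity) hs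
  have heq : ∑ j ∈ Finset.range N, Real.exp (-u) ^ (j + 1) =
      ∑ j ∈ Finset.range N, Real.exp (-u) * Real.exp (-u) ^ j :=
    Finset.sum_congr rfl fun j _ => pow_succ' _ _
  rw [heq]
  refine hle.trans ?_
  rw [← div_eq_mul_inv, div_le_div_iff₀ (by linarith) hu]
  have h2 := Real.add_one_le_exp u
  have h3 : Real.exp (-u) * Real.exp u = 1 := by rw [← Real.exp_add]; simp
  nlinarith

/-- Expanding `-log (1 - x) = ∑ x^i / i` and summing over the factors first bounds the `i`-th term
by `1/(i² t)`; then `ζ(2) = π²/6`. -/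
lemma prod_inv_one_sub_le {t : ℝ} (ht : 0 < t) (w : ℕ) :
    ∏ j ∈ Finset.range w, (1 - Real.exp (-t) ^ (j + 1))⁻¹ ≤ Real.exp (Real.pi ^ 2 / (6 * t)) := by
  have h0 : 0 < Real.exp (-t) := Real.exp_pos _
  have h1 : Real.exp (-t) < 1 := by
    rw [Real.exp_lt_one_iff]
    linarith
  have hlt : ∀ j : ℕ, Real.exp (-t) ^ (j + 1) < 1 := fun j =>
    pow_lt_one₀ h0.le h1 (Nat.succ_ne_zero j)
  have hpos : ∀ j : ℕ, 0 < 1 - Real.exp (-t) ^ (j + 1) := fun j => by linarith [hlt j]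
  rw [← Real.log_le_iff_le_exp (Finset.prod_pos fun j _ => inv_pos.2 (hpos j)),
    Real.log_prod (fun j _ => (inv_pos.2 (hpos j)).ne')]
  simp_rw [Real.log_inv]
  have hs := hasSum_sum (s := Finset.range w) fun j _ =>
    Real.hasSum_pow_div_log_of_abs_lt_one (x := Real.exp (-t) ^ (j + 1))
      (by rw [abs_of_pos (by positivity)]; exact hlt j)
  have hz := ((hasSum_nat_add_iff' 1).2 hasSum_zeta_two).mul_right (1 / t)
  rw [Finset.sum_range_one, Nat.cast_zero, zero_pow two_ne_zero, div_zero, sub_zero] at hz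
  have := hasSum_le (fun i => ?_) hs hz
  · refine this.trans (le_of_eq ?_)
    field_simp
  · have hi : (0 : ℝ) < (i : ℝ) + 1 := by positivity
    have h := sum_range_pow_le (mul_pos hi ht) w
    calc ∑ j ∈ Finset.range w, (Real.exp (-t) ^ (j + 1)) ^ (i + 1) / ((i : ℝ) + 1)
        = (∑ j ∈ Finset.range w, Real.exp (-(((i : ℝ) + 1) * t)) ^ (j + 1)) / ((i : ℝ) + 1) := by
          rw [Finset.sum_div]
          refine Finset.sum_congr rfl fun j _ => ?_
          rw [← pow_mul, mul_comm (j + 1), pow_mul, ← Real.exp_nat_mul]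
          push_cast
          ring_nf
      _ ≤ (1 / (((i : ℝ) + 1) * t)) / ((i : ℝ) + 1) := by gcongr
      _ = _ := by
          push_cast
          field_simp

/-- The generating function of the planar lower sets. -/
lemma sum_p_two_le {t : ℝ} (ht : 0 < t) (N : ℕ) :
    ∑ n ∈ Finset.range N, (p 2 n : ℝ) * Real.exp (-t) ^ n ≤
      Real.exp (Real.pi ^ 2 / (6 * t)) := by
  refine le_trans (le_of_eq ?_) ((sum_narrow_le (Real.exp_pos _) ?_ N N).trans
    (prod_inv_one_sub_le ht N))
  · refine Finset.sum_congr rfl fun n hn => ?_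
    rw [narrow_self n (Finset.mem_range.1 hn).le]
  · rw [Real.exp_lt_one_iff]
    linarith

lemma alphaTwo_pos : 0 < alphaTwo := by
  unfold alphaTwo
  positivity

lemma alphaTwo_sq : alphaTwo ^ 2 = 2 / 3 * Real.pi ^ 2 := by
  rw [alphaTwo, mul_pow, Real.sq_sqrt (by norm_num)]
  ring

lemma p_two_le (n : ℕ) : (p 2 n : ℝ) ≤ Real.exp (alphaTwo * Real.sqrt n) := by
  rcases Nat.eq_zero_or_pos n with rfl | hn
  · simp [p_zero_right]
  have hn' : (0 : ℝ) < Real.sqrt n := Real.sqrt_pos.2 (by exact_mod_cast hn)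
  have hsq : Real.sqrt n ^ 2 = n := Real.sq_sqrt (by positivity)
  have hα := alphaTwo_pos
  -- The minimizer of `n t + π²/(6t)`: both terms become `α_2 √n / 2`.
  set t := alphaTwo / (2 * Real.sqrt n) with ht_def
  have ht : 0 < t := by positivity
  have h := (Finset.single_le_sum (f := fun k => (p 2 k : ℝ) * Real.exp (-t) ^ k)
    (fun k _ => by positivity) (Finset.self_mem_range_succ n)).trans (sum_p_two_le ht (n + 1))
  rw [← Real.exp_nat_mul, ← le_div_iff₀ (Real.exp_pos _), ← Real.exp_sub] at h
  refine h.trans (Real.exp_le_exp.2 (le_of_eq ?_))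
  have hπ : Real.pi ^ 2 = 3 / 2 * alphaTwo ^ 2 := by rw [alphaTwo_sq]; ring
  rw [hπ, ht_def]
  generalize Real.sqrt n = s at hn' hsq
  rw [← hsq]
  field_simp
  ring

/-! ### The inductive step for the upper bound -/

lemma rpow_le_tangent {x μ a : ℝ} (hx : 0 ≤ x) (hμ : 0 < μ) (ha0 : 0 ≤ a) (ha1 : a ≤ 1) :
    x ^ a ≤ μ ^ a * (1 + a * (x / μ - 1)) := by
  have h := rpow_one_add_le_one_add_mul_self (s := x / μ - 1)
    (by have := div_nonneg hx hμ.le; linarith) ha0 ha1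
  rw [add_sub_cancel, Real.div_rpow hx hμ.le, div_le_iff₀ (Real.rpow_pos_of_pos hμ a)] at h
  linarith

lemma rpow_one_sub_inv_of_pow {d : ℕ} (hd : 1 ≤ d) {n y : ℝ} (hy : 0 < y) (hn : y ^ d = n) :
    n ^ (1 - 1 / (d : ℝ)) = y ^ (d - 1) := by
  have hd' : (d : ℝ) ≠ 0 := by positivity
  rw [← hn, ← Real.rpow_natCast y d, ← Real.rpow_mul hy.le, ← Real.rpow_natCast,
    Nat.cast_sub hd]
  congr 1
  field_simp
  simp

lemma exists_pow_eq {d n : ℕ} (hd : 1 ≤ d) (hn : 1 ≤ n) : ∃ y : ℝ, 1 ≤ y ∧ y ^ d = n := by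
  refine ⟨(n : ℝ) ^ ((d : ℝ)⁻¹), Real.one_le_rpow (by exact_mod_cast hn) (by positivity), ?_⟩
  exact Real.rpow_inv_natCast_pow (by positivity) (by omega)

/-- The bound `p d n ≤ exp (C n ^ (1 - 1/d))` for all `n`. -/
def GrowthBound (d : ℕ) (C : ℝ) : Prop :=
  ∀ n : ℕ, (p d n : ℝ) ≤ Real.exp (C * (n : ℝ) ^ (1 - 1 / (d : ℝ)))

/-- Since `d^n = exp (y ln d · y^(d-1))`, the trivial bound settles all `y ≤ C / ln d`; the
recursion need only treat large `y`, where lower-order terms are absorbed. -/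
lemma p_le_exp_of_small {d n : ℕ} (hd : 1 ≤ d) (hn : 1 ≤ n) {y C : ℝ} (hy : 0 < y)
    (hyn : y ^ d = n) (h : y * Real.log d ≤ C) : (p d n : ℝ) ≤ Real.exp (C * y ^ (d - 1)) := by
  have hd' : (0 : ℝ) < d := by exact_mod_cast hd
  have h1 : p d n ≤ d ^ n := by
    obtain ⟨k, rfl⟩ : ∃ k, n = k + 1 := ⟨n - 1, by omega⟩
    exact (p_le_pow d k).trans (Nat.pow_le_pow_right hd (Nat.le_succ k))
  have h2 : (p d n : ℝ) ≤ (d : ℝ) ^ n := by exact_mod_cast h1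
  refine h2.trans ?_
  rw [← Real.log_le_iff_le_exp (by positivity), Real.log_pow, ← hyn]
  calc y ^ d * Real.log d = (y * Real.log d) * y ^ (d - 1) := by
        rw [← mul_pow_sub_one (Nat.one_le_iff_ne_zero.1 hd) y]
        ring
    _ ≤ _ := by gcongr

/-- The inductive step for the upper bound: `κ` bounds the logarithm of the truncated generating
function in one dimension less at `exp (-t)`. -/
lemma p_succ_le_exp {e n : ℕ} (hn : 1 ≤ n) {y t κ C : ℝ} (hy : 0 < y)
    (hyn : y ^ (e + 1) = n) (hκ : 0 ≤ κ) (hC : 0 ≤ C)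
    (hgen : ∑ k ∈ Finset.range (n + 1), (p e k : ℝ) * Real.exp (-t) ^ k ≤ Real.exp κ)
    (hind : ∀ k < n, (p (e + 1) k : ℝ) ≤ Real.exp (C * (k : ℝ) ^ (1 - 1 / ((e + 1 : ℕ) : ℝ))))
    (ht : t * y ≤ (1 - 1 / ((e + 1 : ℕ) : ℝ)) * C)
    (hineq : Real.log (e + 1) + y * κ + t * n / (e + 1) ≤
      (1 - 1 / ((e + 1 : ℕ) : ℝ)) * C * y ^ e / (e + 1)) :
    (p (e + 1) n : ℝ) ≤ Real.exp (C * y ^ e) := by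
  set a : ℝ := 1 - 1 / ((e + 1 : ℕ) : ℝ) with ha
  have he : (0 : ℝ) < (e : ℝ) + 1 := by positivity
  have ha0 : 0 ≤ a := by
    rw [ha, sub_nonneg, div_le_one (by positivity)]
    push_cast
    linarith [(Nat.cast_nonneg e : (0 : ℝ) ≤ e)]
  have ha1 : a ≤ 1 := by
    rw [ha]
    have : 0 ≤ 1 / ((e + 1 : ℕ) : ℝ) := by positivity
    linarith
  have hn0 : (0 : ℝ) < n := by exact_mod_cast hn
  have hna : (n : ℝ) ^ a = y ^ e := rpow_one_sub_inv_of_pow (Nat.succ_pos e) hy hyn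
  set m := ⌊y⌋₊ with hm
  have hmy : (m : ℝ) ≤ y := Nat.floor_le hy.le
  have hlt : n < (m + 1) ^ (e + 1) := by
    have h1 : y < (m : ℝ) + 1 := Nat.lt_floor_add_one y
    have h2 : (n : ℝ) < ((m : ℝ) + 1) ^ (e + 1) := by
      rw [← hyn]
      exact pow_lt_pow_left₀ h1 hy.le (Nat.succ_ne_zero e)
    exact_mod_cast h2
  -- Removing `N` points lowers the exponent by at least `(aC/y) N`. Of this slope, `t` is reserved
  -- for the generating function, and the rest is used only at the minimal value `N = n/(e+1)`.
  set B := C * y ^ e - (a * C / y - t) * (n / (e + 1)) with hB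
  have hterm : ∀ s ∈ (Fintype.piFinset fun _ : Fin m => Finset.range (n + 1)).filter
      (fun s => n ≤ (e + 1) * ∑ j, s j ∧ ∑ j, s j ≤ n),
      (∏ j, (p e (s j) : ℝ)) * (p (e + 1) (n - ∑ j, s j) : ℝ) ≤
        Real.exp B * ∏ j, ((p e (s j) : ℝ) * Real.exp (-t) ^ s j) := by
    intro s hs
    obtain ⟨-, hlow, hup⟩ := Finset.mem_filter.1 hs
    set N := ∑ j, s j with hN
    have hNpos : 0 < N := by
      rcases Nat.eq_zero_or_pos N with h | h
      · rw [h] at hlow; omega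
      · exact h
    have hlow' : (n : ℝ) / (e + 1) ≤ N := by
      rw [div_le_iff₀ he]
      have : (n : ℝ) ≤ ((e : ℝ) + 1) * N := by exact_mod_cast hlow
      linarith
    have h1 := hind (n - N) (by omega)
    have h2 : ((n - N : ℕ) : ℝ) ^ a ≤ y ^ e - a * N / y := by
      refine (rpow_le_tangent (Nat.cast_nonneg _) hn0 ha0 ha1).trans (le_of_eq ?_)
      rw [hna, Nat.cast_sub hup, ← hyn]
      field_simp
      ring
    have h3 : C * ((n - N : ℕ) : ℝ) ^ a ≤ B + -(t * N) := by
      have h4 : 0 ≤ a * C / y - t := by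
        rw [sub_nonneg, le_div_iff₀ hy]
        exact ht
      have h5 := mul_le_mul_of_nonneg_left h2 hC
      have h6 := mul_le_mul_of_nonneg_left hlow' h4
      have h7 : C * (y ^ e - a * N / y) = C * y ^ e - a * C / y * N := by ring
      rw [hB]
      linarith
    have h8 : ∏ j, ((p e (s j) : ℝ) * Real.exp (-t) ^ s j) =
        (∏ j, (p e (s j) : ℝ)) * Real.exp (-(t * N)) := by
      rw [Finset.prod_mul_distrib, Finset.prod_pow_eq_pow_sum, ← hN, ← Real.exp_nat_mul]
      ring_nf
    rw [h8]
    calc _ ≤ (∏ j, (p e (s j) : ℝ)) * Real.exp (B + -(t * N)) := by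
          gcongr
          exact h1.trans (Real.exp_le_exp.2 h3)
      _ = _ := by rw [Real.exp_add]; ring
  have hmain : (p (e + 1) n : ℝ) ≤ ((e : ℝ) + 1) * (Real.exp B * Real.exp κ ^ m) := by
    calc (p (e + 1) n : ℝ) ≤ ((e : ℝ) + 1) *
          ∑ s ∈ (Fintype.piFinset fun _ : Fin m => Finset.range (n + 1)).filter
          (fun s => n ≤ (e + 1) * ∑ j, s j ∧ ∑ j, s j ≤ n),
          (∏ j, (p e (s j) : ℝ)) * (p (e + 1) (n - ∑ j, s j) : ℝ) := by
          exact_mod_cast p_succ_le m n hlt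
      _ ≤ ((e : ℝ) + 1) * ∑ s ∈ (Fintype.piFinset fun _ : Fin m => Finset.range (n + 1)),
          Real.exp B * ∏ j, ((p e (s j) : ℝ) * Real.exp (-t) ^ s j) := by
          -- The constraint on the total size has been used and is dropped; over the full box of
          -- tuples the sum of products factors.
          refine mul_le_mul_of_nonneg_left ?_ he.le
          refine (Finset.sum_le_sum hterm).trans ?_
          exact Finset.sum_le_sum_of_subset_of_nonneg (Finset.filter_subset _ _)
            fun s _ _ => by positivity
      _ = ((e : ℝ) + 1) * (Real.exp B *
          (∑ k ∈ Finset.range (n + 1), (p e k : ℝ) * Real.exp (-t) ^ k) ^ m) := by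
          have h := Finset.prod_univ_sum (fun _ : Fin m => Finset.range (n + 1))
            (fun _ k => (p e k : ℝ) * Real.exp (-t) ^ k)
          rw [Finset.prod_const, Finset.card_univ, Fintype.card_fin] at h
          rw [← Finset.mul_sum, h]
      _ ≤ _ := by gcongr
  refine hmain.trans ?_
  rw [← Real.exp_log he, ← Real.exp_nat_mul, ← Real.exp_add, ← Real.exp_add, Real.exp_le_exp]
  have h9 : (m : ℝ) * κ ≤ y * κ := by gcongr
  have h10 : (a * C / y - t) * (n / (e + 1)) = a * C * y ^ e / (e + 1) - t * n / (e + 1) := by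
    rw [← hyn]
    field_simp
    ring
  rw [hB, h10]
  linarith

lemma growthBound_of_forall {d : ℕ} (hd : 1 ≤ d) {C : ℝ}
    (h : ∀ (n : ℕ) (y : ℝ), 1 ≤ n → 1 ≤ y → y ^ d = n →
      (∀ k < n, (p d k : ℝ) ≤ Real.exp (C * (k : ℝ) ^ (1 - 1 / (d : ℝ)))) →
      (p d n : ℝ) ≤ Real.exp (C * y ^ (d - 1))) (hC : 0 ≤ C) : GrowthBound d C := by
  intro n
  induction n using Nat.strong_induction_on with
  | _ n ih =>
  rcases Nat.eq_zero_or_pos n with rfl | hn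
  · rw [p_zero_right, Nat.cast_one]
    exact Real.one_le_exp (by positivity)
  obtain ⟨y, hy, hyn⟩ := exists_pow_eq hd hn
  rw [rpow_one_sub_inv_of_pow hd (by linarith) hyn]
  exact h n y hn hy hyn ih

/-! ### Dimensions two and three -/

lemma growthBound_two : GrowthBound 2 alphaTwo := by
  intro n
  refine (p_two_le n).trans (le_of_eq ?_)
  rw [Real.sqrt_eq_rpow]
  norm_num

lemma alphaTwo_gt : 2.56 < alphaTwo := by
  refine lt_of_pow_lt_pow_left₀ 2 alphaTwo_pos.le ?_
  rw [alphaTwo_sq]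
  nlinarith [Real.pi_gt_d2]

lemma growthBound_three : GrowthBound 3 (3 * alphaTwo) := by
  have hα := alphaTwo_gt
  refine growthBound_of_forall (by norm_num) (fun n y hn hy hyn ih => ?_) (by linarith)
  have hlog : Real.log 3 ≤ 2 := by
    have := Real.log_le_sub_one_of_pos (show (0 : ℝ) < 3 by norm_num)
    linarith
  rcases le_or_gt (y * 2) (3 * alphaTwo) with hsmall | hbig
  · refine p_le_exp_of_small (by norm_num) hn (by linarith) hyn (le_trans ?_ hsmall)
    exact mul_le_mul_of_nonneg_left hlog (by linarith)
  -- With `t = τ/y`, this `τ` minimizes `yκ + tn/3 = (π²/(6τ) + τ/3) y²`. The result is `(2/3) τ y²`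
  -- against the available `(2/3) α_2 y²`, and `τ < α_2` leaves room for `log 3`.
  set τ := Real.pi / Real.sqrt 2 with hτ
  have hτsq : τ ^ 2 = Real.pi ^ 2 / 2 := by
    rw [hτ, div_pow, Real.sq_sqrt (by norm_num)]
  have hτ0 : 0 < τ := by positivity
  have hτle : τ < 2.23 := by
    refine lt_of_pow_lt_pow_left₀ 2 (by norm_num) ?_
    rw [hτsq]
    nlinarith [Real.pi_lt_d2, Real.pi_pos]
  have hy0 : 0 < y := by linarith
  have hκ : Real.pi ^ 2 / (6 * (τ / y)) = τ * y / 3 := by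
    rw [show Real.pi ^ 2 = 2 * τ ^ 2 by rw [hτsq]; ring]
    field_simp
    ring
  refine p_succ_le_exp (e := 2) (t := τ / y) (κ := Real.pi ^ 2 / (6 * (τ / y))) hn hy0 hyn
    (by positivity) (by linarith) (sum_p_two_le (by positivity) _) ih ?_ ?_
  · rw [div_mul_cancel₀ _ hy0.ne']
    norm_num
    linarith
  · rw [hκ, ← hyn]
    have h1 : τ / y * y ^ (2 + 1) = τ * y ^ 2 := by
      field_simp
    rw [h1]
    norm_num
    nlinarith

/-! ### Dimensions at least four -/

/-- The weight cancels the slope of the tangent line at `μ`, so all `n + 1` terms have the same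
bound, the intercept of that line. The price is `log (n + 1)` per slice. -/
lemma sum_p_le_of_growthBound {e : ℕ} (he : 1 ≤ e) {C μ : ℝ} (hC : 0 ≤ C) (hμ : 0 < μ)
    (hb : GrowthBound e C) (n : ℕ) :
    ∑ k ∈ Finset.range (n + 1), (p e k : ℝ) *
        Real.exp (-(C * (1 - 1 / (e : ℝ)) * (μ ^ (1 - 1 / (e : ℝ)) / μ))) ^ k ≤
      Real.exp (Real.log (n + 1) + C * μ ^ (1 - 1 / (e : ℝ)) / e) := by
  have he' : (1 : ℝ) ≤ e := by exact_mod_cast he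
  have hinv : 1 / (e : ℝ) ≤ 1 := by
    rw [div_le_one (by linarith)]
    exact he'
  have hinv0 : 0 ≤ 1 / (e : ℝ) := by positivity
  set a : ℝ := 1 - 1 / (e : ℝ) with ha
  have hn : (0 : ℝ) < (n : ℝ) + 1 := by positivity
  calc _ ≤ ∑ k ∈ Finset.range (n + 1), Real.exp (C * μ ^ a / e) := by
        refine Finset.sum_le_sum fun k _ => ?_
        rw [← Real.exp_nat_mul]
        calc _ ≤ Real.exp (C * (k : ℝ) ^ a) *
              Real.exp ((k : ℝ) * -(C * a * (μ ^ a / μ))) := by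
              gcongr
              exact hb k
          _ ≤ _ := by
              rw [← Real.exp_add, Real.exp_le_exp]
              have h := mul_le_mul_of_nonneg_left
                (rpow_le_tangent (a := a) (Nat.cast_nonneg k) hμ (by linarith) (by linarith)) hC
              have h2 : C * (μ ^ a * (1 + a * (k / μ - 1))) =
                  k * (C * a * (μ ^ a / μ)) + C * μ ^ a / e := by
                have h3 : a * e = e - 1 := by
                  rw [ha]
                  field_simp
                field_simp
                linear_combination (-C * μ) * h3
              linarith
    _ = _ := by
        rw [Finset.sum_const, Finset.card_range, nsmul_eq_mul, Real.exp_add, Real.exp_log hn]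
        push_cast
        ring

lemma p_succ_le_exp_of_growthBound {e n : ℕ} (he : 1 ≤ e) (hn : 1 ≤ n) {y C C' D : ℝ}
    (hy : 0 < y) (hyn : y ^ (e + 1) = n) (hC' : 0 ≤ C') (hC : 0 ≤ C) (hD : 0 < D)
    (hDe : D ^ e = (e : ℝ) + 1) (hb : GrowthBound e C')
    (hind : ∀ k < n, (p (e + 1) k : ℝ) ≤ Real.exp (C * (k : ℝ) ^ (1 - 1 / ((e + 1 : ℕ) : ℝ))))
    (hCD : C' * D ≤ (1 - 1 / ((e + 1 : ℕ) : ℝ)) * C)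
    (hineq : Real.log (e + 1) + y * Real.log (n + 1) ≤
      y ^ e / (e + 1) * ((1 - 1 / ((e + 1 : ℕ) : ℝ)) * C - C' * D)) :
    (p (e + 1) n : ℝ) ≤ Real.exp (C * y ^ e) := by
  have he' : (1 : ℝ) ≤ e := by exact_mod_cast he
  -- The tangent point is `y^e/(e+1) = n/((e+1) y)`, the mean slice size when `n/d` points are
  -- spread over `y` slices.
  have hμ : 0 < (y / D) ^ e := by positivity
  have hμa : ((y / D) ^ e) ^ (1 - 1 / (e : ℝ)) = (y / D) ^ (e - 1) :=
    rpow_one_sub_inv_of_pow he (div_pos hy hD) rfl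
  have hgen := sum_p_le_of_growthBound he hC' hμ hb n
  rw [hμa] at hgen
  have hpow : (y / D) ^ (e - 1) = D * y ^ e / ((e + 1) * y) := by
    rw [← hDe, div_pow]
    have h1 := mul_pow_sub_one (Nat.one_le_iff_ne_zero.1 he) y
    have h2 := mul_pow_sub_one (Nat.one_le_iff_ne_zero.1 he) D
    rw [← h1, ← h2]
    field_simp
  have hquot : (y / D) ^ (e - 1) / (y / D) ^ e = D / y := by
    rw [hpow, div_pow, hDe]
    field_simp
  rw [hquot, hpow] at hgen
  have hinv : 0 ≤ 1 / (e : ℝ) := by positivity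
  refine p_succ_le_exp hn hy hyn ?_ hC hgen hind ?_ ?_
  · have : 0 ≤ Real.log ((n : ℝ) + 1) := Real.log_nonneg (by linarith [Nat.cast_nonneg (α := ℝ) n])
    positivity
  · rw [mul_assoc, mul_assoc, div_mul_cancel₀ _ hy.ne']
    refine le_trans ?_ hCD
    have : 0 ≤ C' * D := by positivity
    nlinarith
  · rw [← hyn]
    have h1 : C' * (1 - 1 / (e : ℝ)) * (D / y) * y ^ (e + 1) / ((e : ℝ) + 1) =
        y ^ e / (e + 1) * (C' * D * (1 - 1 / (e : ℝ))) := by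
      rw [pow_succ]
      field_simp
    have h2 : y * (Real.log (y ^ (e + 1) + 1) + C' * (D * y ^ e / ((e + 1) * y)) / e) =
        y * Real.log (n + 1) + y ^ e / (e + 1) * (C' * D * (1 / (e : ℝ))) := by
      rw [hyn]
      field_simp
    rw [h1, h2]
    have h3 : (1 - 1 / ((e + 1 : ℕ) : ℝ)) * C * y ^ e / ((e : ℝ) + 1) =
        y ^ e / (e + 1) * ((1 - 1 / ((e + 1 : ℕ) : ℝ)) * C) := by ring
    rw [h3]
    linarith

lemma log_one_add_le_quarter {y : ℝ} (hy : 10 ≤ y) : Real.log (1 + y) ≤ y / 4 := by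
  have h1 : Real.log (1 + y) = Real.log ((1 + y) / 8) + 3 * Real.log 2 := by
    rw [Real.log_div (by linarith) (by norm_num), show (8 : ℝ) = 2 ^ 3 by norm_num, Real.log_pow]
    push_cast
    ring
  have h2 := Real.log_le_sub_one_of_pos (show 0 < (1 + y) / 8 by linarith)
  linarith [Real.log_two_lt_d9]

lemma log_nat_add_one_le {d n : ℕ} (hd : 1 ≤ d) {y : ℝ} (hy : 10 ≤ y) (hyn : y ^ d = n) :
    Real.log (n + 1) ≤ d * (y / 4) := by
  have h1 : (n : ℝ) + 1 ≤ (1 + y) ^ d := by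
    have := pow_add_pow_le (n := d) zero_le_one (show 0 ≤ y by linarith) (by omega)
    rw [one_pow, hyn] at this
    linarith
  calc Real.log (n + 1) ≤ Real.log ((1 + y) ^ d) := Real.log_le_log (by positivity) h1
    _ = d * Real.log (1 + y) := Real.log_pow _ _
    _ ≤ _ := by
      gcongr
      exact log_one_add_le_quarter hy

lemma upperConst_eq {d : ℕ} (hd : 1 ≤ d) :
    upperConst d = alphaTwo * Real.exp (Real.log d ^ 2) := by
  rw [upperConst, Real.rpow_def_of_pos (by exact_mod_cast hd), sq]

lemma exp_log_four_sq : 6.7 ≤ Real.exp (Real.log 4 ^ 2) := by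
  have h1 : 1.386 ≤ Real.log 4 := by
    rw [show (4 : ℝ) = 2 ^ 2 by norm_num, Real.log_pow]
    push_cast
    linarith [Real.log_two_gt_d9]
  -- Splitting the exponent into eight parts makes the quadratic Taylor bound accurate enough.
  have h2 : (8 : ℕ) * (0.24 : ℝ) ≤ Real.log 4 ^ 2 := by
    push_cast
    nlinarith
  refine le_trans ?_ (Real.exp_le_exp.2 h2)
  rw [Real.exp_nat_mul]
  have h3 := Real.quadratic_le_exp_of_nonneg (show (0 : ℝ) ≤ 0.24 by norm_num)
  refine le_trans ?_ (pow_le_pow_left₀ (by norm_num) h3 8)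
  norm_num

lemma upperConst_pos {d : ℕ} (hd : 1 ≤ d) : 0 < upperConst d := by
  rw [upperConst_eq hd]
  exact mul_pos alphaTwo_pos (Real.exp_pos _)

/-- The step starts from the sharper `3 α_2` in dimension three: `upperConst 3` is about `3.34 α_2`,
and `3.34 · 4^(1/3)` exceeds `(3/4) · 4^(ln 4)`. The factor `0.98` is kept in all later dimensions
and makes the final bound strict. -/
lemma growthBound_four : GrowthBound 4 (0.98 * upperConst 4) := by
  have hα := alphaTwo_gt
  have hC0 := upperConst_pos (d := 4) (by norm_num)
  have hC : 6.7 * alphaTwo ≤ upperConst 4 := by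
    rw [upperConst_eq (by norm_num), mul_comm]
    exact mul_le_mul_of_nonneg_left (by exact_mod_cast exp_log_four_sq) alphaTwo_pos.le
  have hlog : Real.log 4 ≤ 1.3864 := by
    rw [show (4 : ℝ) = 2 ^ 2 by norm_num, Real.log_pow]
    push_cast
    linarith [Real.log_two_lt_d9]
  refine growthBound_of_forall (by norm_num) (fun n y hn hy hyn ih => ?_) (by linarith)
  rcases le_or_gt (y * 1.3864) (0.98 * upperConst 4) with hsmall | hbig
  · refine p_le_exp_of_small (by norm_num) hn (by linarith) hyn (le_trans ?_ hsmall)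
    exact mul_le_mul_of_nonneg_left hlog (by linarith)
  have hy12 : 12 ≤ y := by linarith
  have hD : ((4 : ℝ) ^ ((3 : ℕ) : ℝ)⁻¹) ^ 3 = 4 := Real.rpow_inv_natCast_pow (by norm_num) (by norm_num)
  set D := (4 : ℝ) ^ ((3 : ℕ) : ℝ)⁻¹
  have hD0 : 0 < D := by positivity
  have hD1 : D ≤ 1.5875 := by
    refine le_of_pow_le_pow_left₀ (n := 3) (by norm_num) (by norm_num) ?_
    rw [hD]
    norm_num
  have hgap : 0.41 ≤ (1 - 1 / ((3 + 1 : ℕ) : ℝ)) * (0.98 * upperConst 4) - 3 * alphaTwo * D := by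
    norm_num
    nlinarith
  refine p_succ_le_exp_of_growthBound (e := 3) (by norm_num) hn (by linarith) hyn
    (by linarith) (by linarith) hD0 (by rw [hD]; norm_num) growthBound_three ih (by linarith) ?_
  have h1 := log_nat_add_one_le (d := 4) (by norm_num) (by linarith) hyn
  have h2 : y * Real.log (n + 1) ≤ y * ((4 : ℕ) * (y / 4)) := by gcongr
  have h3 : y ^ 3 / ((3 : ℕ) + 1) * 0.41 ≤ y ^ 3 / ((3 : ℕ) + 1) *
      ((1 - 1 / ((3 + 1 : ℕ) : ℝ)) * (0.98 * upperConst 4) - 3 * alphaTwo * D) := by gcongr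
  refine le_trans ?_ h3
  have h4 : Real.log (((3 : ℕ) : ℝ) + 1) ≤ 1.3864 := by
    norm_num
    linarith
  push_cast at *
  nlinarith [mul_nonneg (sq_nonneg y) (sub_nonneg.2 hy12)]

lemma log_ge_of_five_le {d : ℕ} (hd : 5 ≤ d) : 1.6 ≤ Real.log d := by
  have h1 : Real.log 5 ≤ Real.log d := Real.log_le_log (by norm_num) (by exact_mod_cast hd)
  have h2 : Real.log 5 = 2 * Real.log 2 + Real.log (1 + 1 / 4) := by
    rw [show (1 + 1 / 4 : ℝ) = 5 / 2 ^ 2 by norm_num, Real.log_div (by norm_num) (by norm_num),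
      Real.log_pow]
    push_cast
    ring
  have h3 := Real.le_log_one_add_of_nonneg (show (0 : ℝ) ≤ 1 / 4 by norm_num)
  norm_num at h3 h2
  linarith [Real.log_two_gt_d9]

/-- The logarithmic gain of `d ^ log d` over the factor lost in the inductive step. -/
lemma log_gain {e : ℕ} (he : 4 ≤ e) :
    0.095 / ((e : ℝ) + 1) ≤
      (Real.log (e + 1) - Real.log e) * (Real.log (e + 1) + Real.log e - 1) -
        Real.log (e + 1) / e := by
  have he' : (4 : ℝ) ≤ e := by exact_mod_cast he
  have he0 : (0 : ℝ) < e := by linarith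
  have hl : 1.6 ≤ Real.log ((e : ℝ) + 1) := by exact_mod_cast log_ge_of_five_le (d := e + 1) (by omega)
  have hL : Real.log ((e : ℝ) + 1) - Real.log e = Real.log (1 + 1 / e) := by
    rw [← Real.log_div (by positivity) (by positivity)]
    congr 1
    field_simp
  -- The lower bound `2/(2e+1)` is needed for the main term; `1/e` suffices for the subtracted
  -- square.
  have hL1 := Real.le_log_one_add_of_nonneg (show (0 : ℝ) ≤ 1 / e by positivity)
  have hL2 := Real.log_le_sub_one_of_pos (show (0 : ℝ) < 1 + 1 / e by positivity)
  rw [← hL] at hL1 hL2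
  have hL1' : 2 * (1 / (e : ℝ)) / (1 / e + 2) = 2 / (2 * e + 1) := by
    field_simp
    ring
  rw [hL1'] at hL1
  set l := Real.log ((e : ℝ) + 1)
  set L := l - Real.log e with hLdef
  have hl' : Real.log e = l - L := by rw [hLdef]; ring
  rw [hl']
  have hL0 : 0 ≤ L := le_trans (by positivity) hL1
  have hL2' : L ≤ 1 / e := by linarith
  have hsq : L ^ 2 ≤ (1 / (e : ℝ)) ^ 2 := pow_le_pow_left₀ hL0 hL2' 2
  have h1 : 2 / (2 * e + 1) * (2 * l - 1) ≤ L * (2 * l - 1) :=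
    mul_le_mul_of_nonneg_right hL1 (by linarith)
  have h2 : L * (l + (l - L) - 1) - l / e = L * (2 * l - 1) - L ^ 2 - l / e := by ring
  rw [h2]
  suffices h : 0.095 / ((e : ℝ) + 1) ≤ 2 / (2 * e + 1) * (2 * l - 1) - (1 / (e : ℝ)) ^ 2 - l / e by
    linarith
  have h3 : 2 / (2 * e + 1) * (2 * l - 1) - (1 / (e : ℝ)) ^ 2 - l / e =
      l * ((2 * e - 1) / ((2 * e + 1) * e)) - 2 / (2 * e + 1) - 1 / e ^ 2 := by
    field_simp
    ring
  have h4 : 1.6 * ((2 * e - 1) / ((2 * e + 1) * e)) ≤ l * ((2 * e - 1) / ((2 * (e : ℝ) + 1) * e)) := by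
    refine mul_le_mul_of_nonneg_right hl (div_nonneg (by linarith) (by positivity))
  rw [h3]
  suffices h : 0.095 / ((e : ℝ) + 1) ≤
      1.6 * ((2 * e - 1) / ((2 * e + 1) * e)) - 2 / (2 * e + 1) - 1 / (e : ℝ) ^ 2 by linarith
  have h5 : 1.6 * ((2 * e - 1) / ((2 * e + 1) * e)) - 2 / (2 * e + 1) - 1 / (e : ℝ) ^ 2 =
      (1.2 * (e : ℝ) ^ 2 - 3.6 * e - 1) / ((2 * e + 1) * e ^ 2) := by
    field_simp
    ring
  rw [h5, div_le_div_iff₀ (by positivity) (by positivity)]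
  nlinarith [mul_nonneg (sq_nonneg (e : ℝ)) (sub_nonneg.2 he'), sq_nonneg (e : ℝ)]

/-- Absorbs the lower-order terms `log d + y log (n + 1)` of the inductive step into its gap. The
case `e = 4` is separate because `(e+1)³ ≤ y³` would require `y^5 ≤ y^e`. -/
lemma add_le_of_two_mul_le {e : ℕ} (he : 4 ≤ e) {l y : ℝ} (hl : l ≤ e)
    (hy2 : 2 * ((e : ℝ) + 1) ≤ y) :
    l + y * (((e : ℝ) + 1) * (y / 4)) ≤ 1.5 * y ^ e / ((e : ℝ) + 1) ^ 2 := by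
  have he' : (4 : ℝ) ≤ e := by exact_mod_cast he
  have hysq : 100 ≤ y ^ 2 := by nlinarith
  have h5 : ((e : ℝ) + 1) ^ 3 * y ^ 2 ≤ 3 * y ^ e := by
    rcases Nat.lt_or_ge e 5 with h | h
    · obtain rfl : e = 4 := by omega
      norm_num at hy2 ⊢
      have h7 : y ^ 4 = y ^ 2 * y ^ 2 := by ring
      rw [h7]
      exact (mul_le_mul_of_nonneg_right (by linarith) (sq_nonneg y)).trans (mul_assoc _ _ _).le
    · have h6 : y ^ 5 ≤ y ^ e := pow_le_pow_right₀ (by linarith) h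
      have h7 : ((e : ℝ) + 1) ^ 3 ≤ y ^ 3 := by
        gcongr
        linarith
      have h8 := mul_le_mul_of_nonneg_right h7 (sq_nonneg y)
      rw [← pow_add, show 3 + 2 = 5 by norm_num] at h8
      have h9 : 0 ≤ y ^ e := pow_nonneg (by linarith) e
      linarith
  rw [le_div_iff₀ (by positivity)]
  have h7 := mul_le_mul_of_nonneg_left hysq (show 0 ≤ (e : ℝ) + 1 by linarith)
  have h8 : l + y * (((e : ℝ) + 1) * (y / 4)) ≤ ((e : ℝ) + 1) * y ^ 2 / 2 := by linarith
  refine (mul_le_mul_of_nonneg_right h8 (sq_nonneg ((e : ℝ) + 1))).trans ?_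
  linarith

lemma growthBound_succ {e : ℕ} (he : 4 ≤ e) (hb : GrowthBound e (0.98 * upperConst e)) :
    GrowthBound (e + 1) (0.98 * upperConst (e + 1)) := by
  have hα := alphaTwo_gt
  have he' : (4 : ℝ) ≤ e := by exact_mod_cast he
  have he0 : (0 : ℝ) < e := by linarith
  have hC0 := upperConst_pos (d := e + 1) (by omega)
  have hC0' := upperConst_pos (d := e) (by omega)
  have hl : 1.6 ≤ Real.log ((e : ℝ) + 1) := by exact_mod_cast log_ge_of_five_le (d := e + 1) (by omega)
  have hCeq := upperConst_eq (d := e + 1) (by omega)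
  have hCeq' := upperConst_eq (d := e) (by omega)
  push_cast at hCeq
  refine growthBound_of_forall (by omega) (fun n y hn hy hyn ih => ?_) (by linarith)
  rw [Nat.add_sub_cancel]
  rcases le_or_gt (y * Real.log ((e + 1 : ℕ) : ℝ)) (0.98 * upperConst (e + 1)) with hsmall | hbig
  · exact p_le_exp_of_small (by omega) hn (by linarith) hyn hsmall
  push_cast at hbig
  have hgain := log_gain he
  set l := Real.log ((e : ℝ) + 1) with hldef
  set l' := Real.log (e : ℝ) with hldef'
  have hexpl : Real.exp l = (e : ℝ) + 1 := Real.exp_log (by linarith)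
  have hexpl' : Real.exp l' = (e : ℝ) := Real.exp_log (by linarith)
  -- Outside the trivial range `y > 0.98 α_2 exp(l²)/l`; here `exp(l² - l) ≥ l² - l + 1 ≥ 0.8 l` and
  -- `0.98 α_2 ≥ 2.5`.
  have hy2 : 2 * ((e : ℝ) + 1) ≤ y := by
    have h1 := Real.add_one_le_exp (l ^ 2 - l)
    have h2 : Real.exp (l ^ 2) = Real.exp (l ^ 2 - l) * (e + 1) := by
      rw [← hexpl, ← Real.exp_add]
      ring_nf
    have h3 : 0.8 * l ≤ Real.exp (l ^ 2 - l) := by nlinarith [sq_nonneg (l - 0.9)]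
    have h4 : 0.8 * l * (e + 1) ≤ Real.exp (l ^ 2) := by
      rw [h2]
      gcongr
    have h5 : 2.5 * (0.8 * l * (e + 1)) ≤ 0.98 * upperConst (e + 1) := by
      rw [hCeq]
      linarith [mul_nonneg (sub_nonneg.2 hα.le) (Real.exp_pos (l ^ 2)).le, Real.exp_pos (l ^ 2)]
    have h6 : (2 * ((e : ℝ) + 1)) * l ≤ y * l := by linarith
    exact le_of_mul_le_mul_right h6 (by linarith)
  set D := Real.exp (l / e) with hDdef
  have hD0 : 0 < D := Real.exp_pos _
  have hD1 : 1 ≤ D := Real.one_le_exp (by positivity)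
  have hD : D ^ e = (e : ℝ) + 1 := by
    rw [hDdef, ← Real.exp_nat_mul, mul_div_cancel₀ _ he0.ne', hexpl]
  -- The logarithm of the new constant times `e/(e+1)` over the old one times `D`; the step closes
  -- because `R > 0`.
  set R := (l - l') * (l + l' - 1) - l / e with hRdef
  have haC : (1 - 1 / ((e + 1 : ℕ) : ℝ)) * (0.98 * upperConst (e + 1)) =
      0.98 * upperConst e * D * Real.exp R := by
    have h1 : 1 - 1 / ((e + 1 : ℕ) : ℝ) = Real.exp (l' - l) := by
      rw [Real.exp_sub, hexpl, hexpl']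
      push_cast
      field_simp
      ring
    rw [h1, hCeq, hCeq', hDdef]
    have h2 : Real.exp (l' - l) * Real.exp (l ^ 2) =
        Real.exp (l' ^ 2) * Real.exp (l / e) * Real.exp R := by
      rw [← Real.exp_add, ← Real.exp_add, ← Real.exp_add, hRdef]
      ring_nf
    linear_combination (0.98 * alphaTwo) * h2
  have hC16 : 16.8 ≤ 0.98 * upperConst e * D := by
    have h1 : Real.log 4 ≤ l' := Real.log_le_log (by norm_num) he'
    have h2 : Real.log 4 ^ 2 ≤ l' ^ 2 := pow_le_pow_left₀ (Real.log_nonneg (by norm_num)) h1 2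
    have h3 := exp_log_four_sq.trans (Real.exp_le_exp.2 h2)
    rw [hCeq']
    nlinarith
  have hR0 : 0 ≤ R := le_trans (by positivity) hgain
  have hgap : 1.5 / ((e : ℝ) + 1) ≤
      (1 - 1 / ((e + 1 : ℕ) : ℝ)) * (0.98 * upperConst (e + 1)) - 0.98 * upperConst e * D := by
    rw [haC]
    have h1 := Real.add_one_le_exp R
    have h2 : 16.8 * R ≤ 0.98 * upperConst e * D * (Real.exp R - 1) :=
      mul_le_mul hC16 (by linarith) hR0 (by linarith)
    have h3 : 1.5 / ((e : ℝ) + 1) ≤ 16.8 * (0.095 / ((e : ℝ) + 1)) := by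
      rw [← mul_div_assoc]
      gcongr
      norm_num
    linarith
  have hgap0 : 0 ≤ 1.5 / ((e : ℝ) + 1) := by positivity
  refine p_succ_le_exp_of_growthBound (by omega) hn (by linarith) hyn
    (by linarith) (by linarith) hD0 hD hb ih (by linarith) ?_
  have h1 := log_nat_add_one_le (d := e + 1) (by omega) (by linarith) hyn
  have h2 : y * Real.log (n + 1) ≤ y * ((e + 1 : ℕ) * (y / 4)) := by gcongr
  have h3 : y ^ e / ((e : ℝ) + 1) * (1.5 / ((e : ℝ) + 1)) ≤ y ^ e / ((e : ℝ) + 1) *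
      ((1 - 1 / ((e + 1 : ℕ) : ℝ)) * (0.98 * upperConst (e + 1)) - 0.98 * upperConst e * D) := by
    gcongr
  refine le_trans ?_ h3
  have h4 : l ≤ e := by
    have := Real.log_le_sub_one_of_pos (show (0 : ℝ) < e + 1 by linarith)
    linarith
  have h6 : y ^ e / ((e : ℝ) + 1) * (1.5 / ((e : ℝ) + 1)) = 1.5 * y ^ e / ((e : ℝ) + 1) ^ 2 := by
    field_simp
  rw [h6]
  push_cast at h2
  exact (add_le_add_right h2 _).trans (add_le_of_two_mul_le he h4 hy2)

lemma growthBound_of_four_le {d : ℕ} (hd : 4 ≤ d) : GrowthBound d (0.98 * upperConst d) := by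
  induction d, hd using Nat.le_induction with
  | base => exact growthBound_four
  | succ e he ih => exact growthBound_succ he ih

lemma exists_growthBound_lt {d : ℕ} (hd : 2 ≤ d) :
    ∃ C, 0 ≤ C ∧ C < upperConst d ∧ GrowthBound d C := by
  have hα := alphaTwo_gt
  obtain rfl | rfl | h : d = 2 ∨ d = 3 ∨ 4 ≤ d := by omega
  · refine ⟨_, by linarith, ?_, growthBound_two⟩
    rw [upperConst_eq (by norm_num)]
    refine lt_mul_of_one_lt_right alphaTwo_pos (Real.one_lt_exp_iff.2 ?_)
    have : 0 < Real.log ((2 : ℕ) : ℝ) := Real.log_pos (by norm_num)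
    positivity
  · refine ⟨_, by linarith, ?_, growthBound_three⟩
    rw [upperConst_eq (by norm_num), mul_comm]
    refine mul_lt_mul_of_pos_left ?_ alphaTwo_pos
    have h1 : 1 < Real.log ((3 : ℕ) : ℝ) := by
      rw [Real.lt_log_iff_exp_lt (by norm_num)]
      push_cast
      linarith [Real.exp_one_lt_d9]
    have h2 : Real.exp (Real.log ((3 : ℕ) : ℝ)) = 3 := by
      rw [Real.exp_log (by norm_num)]
      norm_num
    rw [← h2, Real.exp_lt_exp]
    nlinarith
  · refine ⟨_, ?_, ?_, growthBound_of_four_le h⟩ <;>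
    linarith [upperConst_pos (d := d) (by omega)]

/-! ### Lower bound from one free layer -/

/-- The points of `ℕ^d` with coordinate sum `r`. -/
def layer (d r : ℕ) : Finset (Fin d → ℕ) := Finset.piAntidiag Finset.univ r

lemma mem_layer {d r : ℕ} {k : Fin d → ℕ} : k ∈ layer d r ↔ ∑ i, k i = r := by
  simp [layer]

lemma card_layer (e r : ℕ) : (layer (e + 1) r).card = (r + e).choose e := by
  rw [layer, ← Finset.map_sym_eq_piAntidiag, Finset.card_map, Finset.sym_univ,
    Finset.card_univ, Sym.card_sym_eq_multichoose, Fintype.card_fin, Nat.multichoose_eq,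
    show e + 1 + r - 1 = r + e by omega,
    Nat.choose_symm_add]

/-- The points of `ℕ^d` with coordinate sum less than `L`. -/
def simplex (d L : ℕ) : Finset (Fin d → ℕ) := (Finset.range L).biUnion (layer d)

lemma mem_simplex {d L : ℕ} {k : Fin d → ℕ} : k ∈ simplex d L ↔ ∑ i, k i < L := by
  simp [simplex, mem_layer]

lemma card_simplex (e L : ℕ) : (simplex (e + 1) L).card = (L + e).choose (e + 1) := by
  rw [simplex, Finset.card_biUnion]
  · simp_rw [card_layer]
    induction L with
    | zero => simp
    | succ L ih =>
      rw [Finset.sum_range_succ, ih, show L + 1 + e = L + e + 1 by omega,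
        Nat.choose_succ_succ' (L + e) e, add_comm]
  · intro i _ j _ hij
    rw [Function.onFun, Finset.disjoint_left]
    intro k hk hk'
    exact hij ((mem_layer.1 hk).symm.trans (mem_layer.1 hk'))

lemma isLowerSet_simplex (d L : ℕ) : IsLowerSet (simplex d L : Set (Fin d → ℕ)) := by
  intro x y hyx hx
  rw [Finset.mem_coe, mem_simplex] at hx ⊢
  exact (Finset.sum_le_sum fun i _ => hyx i).trans_lt hx

lemma sum_lt_of_lt {d : ℕ} {x y : Fin d → ℕ} (hle : y ≤ x) (hne : y ≠ x) :
    ∑ i, y i < ∑ i, x i := by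
  obtain ⟨i, hi⟩ := (Pi.lt_def.1 (lt_of_le_of_ne hle hne)).2
  exact Finset.sum_lt_sum (fun i _ => hle i) ⟨i, Finset.mem_univ _, hi⟩

lemma sum_single_apply {d : ℕ} (i : Fin d) (m : ℕ) : ∑ l, (Pi.single i m : Fin d → ℕ) l = m := by
  simp

open scoped Classical in
/-- The lower sets inside the simplex of side `l + 1` that contain its vertex on the first axis. -/
noncomputable def vertexLowerSets (e l : ℕ) : Finset (Finset (Fin (e + 1) → ℕ)) :=
  (simplex (e + 1) (l + 1)).powerset.filter fun Q =>
    IsLowerSet (Q : Set (Fin (e + 1) → ℕ)) ∧ Pi.single 0 l ∈ Q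

lemma mem_vertexLowerSets {e l : ℕ} {Q : Finset (Fin (e + 1) → ℕ)} :
    Q ∈ vertexLowerSets e l ↔ Q ⊆ simplex (e + 1) (l + 1) ∧
      IsLowerSet (Q : Set (Fin (e + 1) → ℕ)) ∧ Pi.single 0 l ∈ Q := by
  classical
  rw [vertexLowerSets, Finset.mem_filter, Finset.mem_powerset]

/-- Filling up along the first axis turns these sets into lower sets of any large size. -/
lemma card_vertexLowerSets_le {e l n : ℕ} (hn : (l + 1 + e).choose (e + 1) ≤ n) :
    (vertexLowerSets e l).card ≤ p (e + 1) n := by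
  classical
  rw [← card_lowerFinset]
  set ray : ℕ → Finset (Fin (e + 1) → ℕ) := fun m =>
    (Finset.range m).image fun j => Pi.single 0 (l + 1 + j) with hray
  have hraysum : ∀ m, ∀ k ∈ ray m, l + 1 ≤ ∑ i, k i := by
    intro m k hk
    obtain ⟨j, -, rfl⟩ := Finset.mem_image.1 hk
    rw [sum_single_apply]
    omega
  refine Finset.card_le_card_of_injOn (fun Q => Q ∪ ray (n - Q.card)) ?_ ?_
  · intro Q hQ
    obtain ⟨hsub, hl, hv⟩ := mem_vertexLowerSets.1 hQ
    rw [Finset.mem_coe, mem_lowerFinset]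
    constructor
    · intro x y hyx hx
      rw [Finset.mem_coe, Finset.mem_union] at hx ⊢
      rcases hx with hx | hx
      · exact Or.inl (hl hyx hx)
      · obtain ⟨j, hj, rfl⟩ := Finset.mem_image.1 hx
        have hj := Finset.mem_range.1 hj
        -- Anything below a point of the axis is on the axis: it is either on the added ray or below
        -- the vertex, which lies in `Q`.
        have hy : y = Pi.single 0 (y 0) := by
          funext i
          by_cases hi : i = 0
          · subst hi
            simp
          · have := hyx i
            simpa [hi] using this
        have hy0 : y 0 ≤ l + 1 + j := by simpa using hyx 0
        rcases Nat.lt_or_ge l (y 0) with h | h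
        · right
          refine Finset.mem_image.2 ⟨y 0 - (l + 1), Finset.mem_range.2 (by omega), ?_⟩
          rw [show l + 1 + (y 0 - (l + 1)) = y 0 by omega]
          exact hy.symm
        · left
          refine hl ?_ hv
          rw [hy]
          exact single_le_of_le (by simpa using h)
    · rw [Finset.card_union_of_disjoint, Finset.card_image_of_injective, Finset.card_range]
      · have := Finset.card_le_card hsub
        rw [card_simplex] at this
        omega
      · intro a b hab
        have := congrFun hab 0
        simp at this
        exact this
      · rw [Finset.disjoint_left]
        intro k hk hk'
        have h1 := mem_simplex.1 (hsub hk)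
        have h2 := hraysum _ k hk'
        omega
  · intro Q hQ Q' hQ' h
    -- The added ray lies outside the simplex, so cutting back to the simplex recovers `Q`.
    have key : ∀ Q ∈ vertexLowerSets e l,
        (Q ∪ ray (n - Q.card)).filter (fun k => ∑ i, k i < l + 1) = Q := by
      intro Q hQ
      obtain ⟨hsub, -, -⟩ := mem_vertexLowerSets.1 hQ
      ext k
      rw [Finset.mem_filter, Finset.mem_union]
      constructor
      · rintro ⟨h | h, h2⟩
        · exact h
        · have := hraysum _ k h
          omega
      · exact fun h => ⟨Or.inl h, mem_simplex.1 (hsub h)⟩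
    rw [← key Q hQ, ← key Q' hQ']
    exact congrArg _ h

lemma isLowerSet_simplex_union {d r : ℕ} {S : Finset (Fin d → ℕ)} (hS : S ⊆ layer d r) :
    IsLowerSet ((simplex d r ∪ S : Finset (Fin d → ℕ)) : Set (Fin d → ℕ)) := by
  intro x y hyx hx
  rw [Finset.mem_coe, Finset.mem_union] at hx ⊢
  rcases hx with hx | hx
  · exact Or.inl (isLowerSet_simplex d r hyx hx)
  · by_cases hxy : y = x
    · exact Or.inr (hxy ▸ hx)
    · left
      rw [mem_simplex, ← mem_layer.1 (hS hx)]
      exact sum_lt_of_lt hyx hxy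

lemma single_mem_layer {d : ℕ} (i : Fin d) (r : ℕ) : Pi.single i r ∈ layer d r :=
  mem_layer.2 (sum_single_apply i r)

lemma filter_simplex_union {d r : ℕ} {S : Finset (Fin d → ℕ)} (hS : S ⊆ layer d r) :
    (simplex d r ∪ S).filter (fun k => ∑ i, k i = r) = S := by
  ext k
  rw [Finset.mem_filter, Finset.mem_union, mem_simplex]
  constructor
  · rintro ⟨h | h, h2⟩
    · omega
    · exact h
  · exact fun h => ⟨Or.inr h, mem_layer.1 (hS h)⟩

/-- Points of one layer are pairwise incomparable and everything strictly below them is in the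
simplex, so all of the layer except the forced vertex is free. -/
lemma two_pow_le_card_vertexLowerSets (e r : ℕ) :
    2 ^ ((r + e).choose e - 1) ≤ (vertexLowerSets e r).card := by
  classical
  rw [← card_layer e r, ← Finset.card_erase_of_mem (single_mem_layer 0 r), ← Finset.card_powerset]
  have hins : ∀ S ∈ ((layer (e + 1) r).erase (Pi.single 0 r)).powerset,
      insert (Pi.single 0 r) S ⊆ layer (e + 1) r := by
    intro S hS
    rw [Finset.mem_powerset] at hS
    exact Finset.insert_subset (single_mem_layer 0 r) (hS.trans (Finset.erase_subset _ _))
  refine Finset.card_le_card_of_injOn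
    (fun S => simplex (e + 1) r ∪ insert (Pi.single 0 r) S) ?_ ?_
  · intro S hS
    rw [Finset.mem_coe, mem_vertexLowerSets]
    refine ⟨?_, isLowerSet_simplex_union (hins S hS), by simp⟩
    refine Finset.union_subset ?_ ((hins S hS).trans ?_)
    · intro k hk
      rw [mem_simplex] at hk ⊢
      omega
    · intro k hk
      rw [mem_layer] at hk
      rw [mem_simplex]
      omega
  · intro S hS S' hS' h
    have h1 := congrArg (Finset.filter fun k => ∑ i, k i = r) h
    simp only [filter_simplex_union (hins S hS), filter_simplex_union (hins S' hS')] at h1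
    have h2 : ∀ S ∈ ((layer (e + 1) r).erase (Pi.single 0 r)).powerset,
        (Pi.single 0 r : Fin (e + 1) → ℕ) ∉ S := fun S hS hmem =>
      Finset.notMem_erase _ _ (Finset.mem_powerset.1 hS hmem)
    rw [← Finset.erase_insert (h2 S hS), ← Finset.erase_insert (h2 S' hS'), h1]

lemma two_pow_le_p {e r n : ℕ} (hn : (r + 1 + e).choose (e + 1) ≤ n) :
    2 ^ ((r + e).choose e - 1) ≤ p (e + 1) n :=
  (two_pow_le_card_vertexLowerSets e r).trans (card_vertexLowerSets_le hn)

/-- Segments along two different axes. This covers `2 ≤ n ≤ d`, where the free layer has only its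
vertex. -/
lemma two_le_p {e n : ℕ} (he : 1 ≤ e) (hn : 2 ≤ n) : 2 ≤ p (e + 1) n := by
  classical
  obtain ⟨f, rfl⟩ : ∃ f, e = f + 1 := ⟨e - 1, by omega⟩
  rw [← card_lowerFinset]
  set seg : Fin (f + 1 + 1) → Finset (Fin (f + 1 + 1) → ℕ) := fun i =>
    (Finset.range n).image fun j => Pi.single i j with hseg
  have hmem : ∀ i, seg i ∈ lowerFinset (f + 1 + 1) n := by
    intro i
    rw [mem_lowerFinset]
    constructor
    · intro x y hyx hx
      obtain ⟨j, hj, rfl⟩ := Finset.mem_image.1 hx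
      refine Finset.mem_image.2 ⟨y i, ?_, ?_⟩
      · have := hyx i
        rw [Pi.single_eq_same] at this
        exact Finset.mem_range.2 (this.trans_lt (Finset.mem_range.1 hj))
      · funext l
        by_cases hl : l = i
        · subst hl
          simp
        · have := hyx l
          simp only [Pi.single_eq_of_ne hl] at this ⊢
          omega
    · rw [Finset.card_image_of_injective _ (Pi.single_injective i), Finset.card_range]
  have hne : seg 0 ≠ seg 1 := by
    intro h
    have h1 : Pi.single 0 1 ∈ seg 0 :=
      Finset.mem_image.2 ⟨1, Finset.mem_range.2 (by omega), rfl⟩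
    rw [h] at h1
    obtain ⟨j, -, hj⟩ := Finset.mem_image.1 h1
    have := congrFun hj 0
    simp at this
  exact Finset.one_lt_card.2 ⟨_, hmem 0, _, hmem 1, hne⟩

/-! ### Two free layers -/

/-- The points of the layer `r + 1` all of whose lower neighbours lie in `W`. -/
def supported (d r : ℕ) (W : Finset (Fin d → ℕ)) : Finset (Fin d → ℕ) :=
  (layer d (r + 1)).filter fun x => ∀ i, 0 < x i → x - Pi.single i 1 ∈ W

lemma mem_supported {d r : ℕ} {W : Finset (Fin d → ℕ)} {x : Fin d → ℕ} :
    x ∈ supported d r W ↔ x ∈ layer d (r + 1) ∧ ∀ i, 0 < x i → x - Pi.single i 1 ∈ W := by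
  rw [supported, Finset.mem_filter]

lemma isLowerSet_two_layers {d r : ℕ} {W U : Finset (Fin d → ℕ)} (hW : W ⊆ layer d r)
    (hU : U ⊆ supported d r W) :
    IsLowerSet ((simplex d r ∪ W ∪ U : Finset (Fin d → ℕ)) : Set (Fin d → ℕ)) := by
  intro x y hyx hx
  rw [Finset.mem_coe, Finset.mem_union] at hx ⊢
  rcases hx with hx | hx
  · exact Or.inl (isLowerSet_simplex_union hW hyx hx)
  · by_cases hxy : y = x
    · exact Or.inr (hxy ▸ hx)
    · left
      obtain ⟨i, hi⟩ := (Pi.lt_def.1 (lt_of_le_of_ne hyx hxy)).2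
      have h := (mem_supported.1 (hU hx)).2 i (by omega)
      refine isLowerSet_simplex_union hW (a := x - Pi.single i 1) ?_
        (Finset.mem_coe.2 (Finset.mem_union_right _ h))
      intro l
      by_cases hl : l = i
      · subst hl
        simp
        omega
      · simpa [hl] using hyx l

lemma sub_single_mem_layer {d r : ℕ} {x : Fin d → ℕ} (hx : x ∈ layer d (r + 1)) {i : Fin d}
    (hi : 0 < x i) : x - Pi.single i 1 ∈ layer d r := by
  rw [mem_layer] at hx ⊢
  have hle : Pi.single i 1 ≤ x := single_le_of_le hi
  have h1 : ∑ l, (x - Pi.single i 1 + Pi.single i 1 : Fin d → ℕ) l = r + 1 := by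
    rw [tsub_add_cancel_of_le hle, hx]
  simp only [Pi.add_apply, Finset.sum_add_distrib] at h1
  rw [sum_single_apply] at h1
  omega

/-- A point has at most `d` lower neighbours, so a uniformly random subset contains them all with
probability at least `2^(-d)`. The favourable subsets include the whole interval from the neighbour
set `B` to `X`. -/
lemma card_powerset_filter_supported {d r : ℕ} {v x : Fin d → ℕ} (hx : x ∈ layer d (r + 1)) :
    2 ^ ((layer d r).erase v).card ≤
      2 ^ d * ((((layer d r).erase v).powerset).filter
        fun S => ∀ i, 0 < x i → x - Pi.single i 1 ∈ insert v S).card := by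
  set X := (layer d r).erase v with hX
  set B := ((Finset.univ.filter fun i => 0 < x i).image fun i => x - Pi.single i 1).erase v with hB
  have hBX : B ⊆ X := by
    refine Finset.erase_subset_erase _ ?_
    intro k hk
    obtain ⟨i, hi, rfl⟩ := Finset.mem_image.1 hk
    exact sub_single_mem_layer hx (Finset.mem_filter.1 hi).2
  have hBd : B.card ≤ d := by
    refine (Finset.card_erase_le).trans (Finset.card_image_le.trans ?_)
    exact (Finset.card_filter_le _ _).trans (by simp)
  have hsub : Finset.Icc B X ⊆ X.powerset.filter
      fun S => ∀ i, 0 < x i → x - Pi.single i 1 ∈ insert v S := by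
    intro S hS
    obtain ⟨h1, h2⟩ := Finset.mem_Icc.1 hS
    refine Finset.mem_filter.2 ⟨Finset.mem_powerset.2 h2, fun i hi => ?_⟩
    rw [Finset.mem_insert]
    by_cases h : x - Pi.single i 1 = v
    · exact Or.inl h
    · refine Or.inr (h1 (Finset.mem_erase.2 ⟨h, Finset.mem_image.2 ⟨i, ?_, rfl⟩⟩))
      exact Finset.mem_filter.2 ⟨Finset.mem_univ _, hi⟩
  have h1 := Finset.card_le_card hsub
  rw [Finset.card_Icc_finset hBX] at h1
  have h2 := Finset.card_le_card hBX
  calc 2 ^ X.card = 2 ^ B.card * 2 ^ (X.card - B.card) := by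
        rw [← pow_add, Nat.add_sub_cancel' h2]
    _ ≤ _ := Nat.mul_le_mul (Nat.pow_le_pow_right (by norm_num) hBd) h1

lemma sum_card_supported_ge {d r : ℕ} (v v' : Fin d → ℕ) :
    2 ^ ((layer d r).erase v).card * ((layer d (r + 1)).erase v').card ≤
      2 ^ d * ∑ S ∈ ((layer d r).erase v).powerset,
        ((supported d r (insert v S)).erase v').card := by
  set X := (layer d r).erase v with hX
  have h1 : ∀ S, ((supported d r (insert v S)).erase v').card =
      ∑ x ∈ (layer d (r + 1)).erase v',
        if ∀ i, 0 < x i → x - Pi.single i 1 ∈ insert v S then 1 else 0 := by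
    intro S
    rw [← Finset.card_filter, supported, Finset.filter_erase]
  simp_rw [h1]
  rw [Finset.sum_comm]
  simp_rw [← Finset.card_filter]
  rw [Finset.mul_sum, mul_comm, ← smul_eq_mul]
  refine Finset.card_nsmul_le_sum _ _ _ fun x hx => ?_
  exact card_powerset_filter_supported (Finset.mem_of_mem_erase hx)

/-- The only lower neighbour of the new vertex `(r+1) e_1` is the old one `r e_1`; forcing both in
makes the new vertex always available. Each layer of the union returns one of the two choices. -/
lemma sum_two_pow_le_card_vertexLowerSets (e r : ℕ) :
    ∑ S ∈ ((layer (e + 1) r).erase (Pi.single 0 r)).powerset,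
        2 ^ ((supported (e + 1) r (insert (Pi.single 0 r) S)).erase (Pi.single 0 (r + 1))).card ≤
      (vertexLowerSets e (r + 1)).card := by
  classical
  set v : Fin (e + 1) → ℕ := Pi.single 0 r with hv
  set v' : Fin (e + 1) → ℕ := Pi.single 0 (r + 1) with hv'
  simp_rw [← Finset.card_powerset]
  rw [← Finset.card_sigma]
  have hins : ∀ S ∈ ((layer (e + 1) r).erase v).powerset, insert v S ⊆ layer (e + 1) r := by
    intro S hS
    rw [Finset.mem_powerset] at hS
    exact Finset.insert_subset (single_mem_layer 0 r) (hS.trans (Finset.erase_subset _ _))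
  have hv'mem : ∀ S, v' ∈ supported (e + 1) r (insert v S) := by
    intro S
    refine mem_supported.2 ⟨single_mem_layer 0 (r + 1), fun i hi => ?_⟩
    have hi0 : i = 0 := by
      by_contra h
      simp [hv', h] at hi
    subst hi0
    have : v' - Pi.single 0 1 = v := by
      funext l
      by_cases hl : l = 0
      · subst hl
        simp [hv, hv']
      · simp [hv, hv', hl]
    rw [this]
    exact Finset.mem_insert_self _ _
  have hinsU : ∀ S U, U ⊆ (supported (e + 1) r (insert v S)).erase v' →
      insert v' U ⊆ supported (e + 1) r (insert v S) := fun S U hU =>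
    Finset.insert_subset (hv'mem S) (hU.trans (Finset.erase_subset _ _))
  refine Finset.card_le_card_of_injOn
    (fun q => simplex (e + 1) r ∪ insert v q.1 ∪ insert v' q.2) ?_ ?_
  · rintro ⟨S, U⟩ hq
    obtain ⟨hS, hU⟩ := Finset.mem_sigma.1 (Finset.mem_coe.1 hq)
    rw [Finset.mem_powerset] at hU
    rw [Finset.mem_coe, mem_vertexLowerSets]
    refine ⟨?_, isLowerSet_two_layers (hins S hS) (hinsU S U hU), by simp [hv']⟩
    refine Finset.union_subset (Finset.union_subset ?_ ((hins S hS).trans ?_))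
      ((hinsU S U hU).trans ?_)
    · intro k hk
      rw [mem_simplex] at hk ⊢
      omega
    · intro k hk
      rw [mem_layer] at hk
      rw [mem_simplex]
      omega
    · intro k hk
      have := mem_layer.1 (mem_supported.1 hk).1
      rw [mem_simplex]
      omega
  · rintro ⟨S, U⟩ hq ⟨S', U'⟩ hq' h
    have key1 : ∀ S U, S ∈ ((layer (e + 1) r).erase v).powerset →
        U ⊆ (supported (e + 1) r (insert v S)).erase v' →
        (simplex (e + 1) r ∪ insert v S ∪ insert v' U).filter (fun k => ∑ i, k i = r) =
          insert v S := by
      intro S U hS hU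
      rw [Finset.filter_union, filter_simplex_union (hins S hS), Finset.union_eq_left]
      intro k hk
      obtain ⟨hk, hk2⟩ := Finset.mem_filter.1 hk
      have := mem_layer.1 (mem_supported.1 (hinsU S U hU hk)).1
      omega
    have key2 : ∀ S U, S ∈ ((layer (e + 1) r).erase v).powerset →
        U ⊆ (supported (e + 1) r (insert v S)).erase v' →
        (simplex (e + 1) r ∪ insert v S ∪ insert v' U).filter (fun k => ∑ i, k i = r + 1) =
          insert v' U := by
      intro S U hS hU
      ext k
      rw [Finset.mem_filter, Finset.mem_union, Finset.mem_union, mem_simplex]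
      constructor
      · rintro ⟨(h | h) | h, h2⟩
        · omega
        · have := mem_layer.1 (hins S hS h)
          omega
        · exact h
      · exact fun h => ⟨Or.inr h, mem_layer.1 (mem_supported.1 (hinsU S U hU h)).1⟩
    obtain ⟨hS, hU⟩ := Finset.mem_sigma.1 (Finset.mem_coe.1 hq)
    obtain ⟨hS', hU'⟩ := Finset.mem_sigma.1 (Finset.mem_coe.1 hq')
    rw [Finset.mem_powerset] at hU hU'
    have h1 := congrArg (Finset.filter fun k => ∑ i, k i = r) h
    have h2 := congrArg (Finset.filter fun k => ∑ i, k i = r + 1) h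
    simp only [key1 S U hS hU, key1 S' U' hS' hU', key2 S U hS hU, key2 S' U' hS' hU'] at h1 h2
    have h3 : ∀ S ∈ ((layer (e + 1) r).erase v).powerset, v ∉ S := fun S hS hmem =>
      Finset.notMem_erase _ _ (Finset.mem_powerset.1 hS hmem)
    have h4 : ∀ S U, U ⊆ (supported (e + 1) r (insert v S)).erase v' → v' ∉ U :=
      fun S U hU hmem => Finset.notMem_erase _ _ (hU hmem)
    have hSS : S = S' := by
      rw [← Finset.erase_insert (h3 S hS), ← Finset.erase_insert (h3 S' hS'), h1]
    have hUU : U = U' := by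
      rw [← Finset.erase_insert (h4 S U hU), ← Finset.erase_insert (h4 S' U' hU'), h2]
    subst hSS
    subst hUU
    rfl

/-- Jensen's inequality for `2 ^ x`, with a lower bound for the mean. -/
lemma card_mul_two_rpow_le {ι : Type*} (s : Finset ι) (u : ι → ℕ) {c : ℝ}
    (h : s.card * c ≤ ∑ i ∈ s, (u i : ℝ)) :
    s.card * (2 : ℝ) ^ c ≤ ∑ i ∈ s, (2 : ℝ) ^ u i := by
  have hlog : 0 < Real.log 2 := Real.log_pos (by norm_num)
  have h1 : ∀ i ∈ s, (2 : ℝ) ^ c * (1 + Real.log 2 * (u i - c)) ≤ (2 : ℝ) ^ u i := by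
    intro i _
    have h2 : (2 : ℝ) ^ u i = (2 : ℝ) ^ c * Real.exp (Real.log 2 * (u i - c)) := by
      rw [← Real.rpow_natCast, Real.rpow_def_of_pos (by norm_num),
        Real.rpow_def_of_pos (by norm_num), ← Real.exp_add]
      ring_nf
    rw [h2]
    gcongr
    linarith [Real.add_one_le_exp (Real.log 2 * (u i - c))]
  refine le_trans ?_ (Finset.sum_le_sum h1)
  rw [← Finset.mul_sum, Finset.sum_add_distrib, ← Finset.mul_sum, Finset.sum_sub_distrib,
    Finset.sum_const, Finset.sum_const, nsmul_eq_mul, nsmul_eq_mul, mul_one, mul_comm]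
  gcongr
  have := mul_nonneg hlog.le (sub_nonneg.2 h)
  linarith

/-- The average number of free points in the second layer is at least `2^(-d)` times its size
without the vertex, and convexity of `2^x` moves this average into the exponent. -/
lemma two_rpow_le_p {e r n : ℕ} (hn : (r + 2 + e).choose (e + 1) ≤ n) :
    (2 : ℝ) ^ (((r + e).choose e : ℝ) - 1 + (((r + 1 + e).choose e : ℝ) - 1) / 2 ^ (e + 1)) ≤
      p (e + 1) n := by
  have hsum := (sum_two_pow_le_card_vertexLowerSets e r).trans (card_vertexLowerSets_le hn)
  have hsupp := sum_card_supported_ge (d := e + 1) (r := r) (Pi.single 0 r) (Pi.single 0 (r + 1))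
  have hX : ((layer (e + 1) r).erase (Pi.single 0 r)).card = (r + e).choose e - 1 := by
    rw [Finset.card_erase_of_mem (single_mem_layer 0 r), card_layer]
  have hX' : ((layer (e + 1) (r + 1)).erase (Pi.single 0 (r + 1))).card =
      (r + 1 + e).choose e - 1 := by
    rw [Finset.card_erase_of_mem (single_mem_layer 0 (r + 1)), card_layer]
  have hM : 1 ≤ (r + e).choose e := Nat.choose_pos (by omega)
  have hM' : 1 ≤ (r + 1 + e).choose e := Nat.choose_pos (by omega)
  rw [← Finset.card_powerset, hX'] at hsupp
  set P := ((layer (e + 1) r).erase (Pi.single 0 r)).powerset with hP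
  have hPcard : (P.card : ℝ) = (2 : ℝ) ^ (((r + e).choose e : ℝ) - 1) := by
    rw [hP, Finset.card_powerset, hX, Nat.cast_pow, Nat.cast_ofNat, ← Real.rpow_natCast,
      Nat.cast_sub hM, Nat.cast_one]
  have hJ := card_mul_two_rpow_le P
    (fun S => ((supported (e + 1) r (insert (Pi.single 0 r) S)).erase (Pi.single 0 (r + 1))).card)
    (c := (((r + 1 + e).choose e : ℝ) - 1) / 2 ^ (e + 1)) (by
      rw [← mul_div_assoc, div_le_iff₀ (by positivity), mul_comm (Finset.sum _ _)]
      have h : ((P.card * ((r + 1 + e).choose e - 1) : ℕ) : ℝ) ≤ _ := Nat.cast_le.2 hsupp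
      push_cast [Nat.cast_sub hM'] at h
      exact h)
  rw [Real.rpow_add (by norm_num), ← hPcard]
  refine hJ.trans ?_
  exact_mod_cast hsum

/-! ### Comparing layer sizes with the scale `(d! n)^(1/d)` -/

/-- The inequality of arithmetic and geometric means for `R+1, …, R+d`; Bernoulli's inequality
carries the mean from `A` to `A + 1/2`. -/
lemma ascFactorial_le_mean_pow (R d : ℕ) :
    (((R + 1).ascFactorial d : ℕ) : ℝ) ≤ ((R : ℝ) + (d + 1) / 2) ^ d := by
  induction d with
  | zero => simp
  | succ d ih =>
    set A : ℝ := (R : ℝ) + (d + 1) / 2 with hA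
    have hA0 : 0 < A := by positivity
    have hb := one_add_mul_le_pow (a := 1 / (2 * A)) (by
      have : 0 < 1 / (2 * A) := by positivity
      linarith) (d + 1)
    have h1 : A ^ (d + 1) * (1 + ((d + 1 : ℕ) : ℝ) * (1 / (2 * A))) ≤
        A ^ (d + 1) * (1 + 1 / (2 * A)) ^ (d + 1) := by gcongr
    rw [← mul_pow] at h1
    have h2 : A * (1 + 1 / (2 * A)) = (R : ℝ) + ((d + 1 : ℕ) + 1) / 2 := by
      rw [hA]
      push_cast
      field_simp
      ring
    have h3 : A ^ (d + 1) * (1 + ((d + 1 : ℕ) : ℝ) * (1 / (2 * A))) = (R + 1 + d) * A ^ d := by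
      rw [pow_succ]
      push_cast
      field_simp
      rw [hA]
      ring
    rw [h2, h3] at h1
    refine le_trans ?_ h1
    rw [Nat.ascFactorial_succ]
    push_cast
    gcongr

lemma choose_two_layers (r e : ℕ) :
    (r + e).choose e * ((r + e + 1) * (r + e + 2)) =
      (e + 1) * (r + 1) * (r + 2 + e).choose (e + 1) := by
  have h1 := Nat.add_one_mul_choose_eq (r + e) e
  have h2 := Nat.choose_mul_succ_eq (r + e + 1) (e + 1)
  rw [show r + e + 1 + 1 - (e + 1) = r + 1 by omega, show r + e + 1 + 1 = r + 2 + e by ring] at h2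
  calc _ = ((r + e + 1) * (r + e).choose e) * (r + 2 + e) := by ring
    _ = (e + 1) * ((r + e + 1).choose (e + 1) * (r + 2 + e)) := by rw [h1]; ring
    _ = _ := by rw [h2]; ring

/-- The sizes of consecutive simplices bracket every positive integer. -/
lemma exists_choose_le_lt (e n : ℕ) (hn : 1 ≤ n) :
    ∃ r, (r + 1 + e).choose (e + 1) ≤ n ∧ n < (r + 2 + e).choose (e + 1) := by
  have hstep : ∀ r, (r + e).choose (e + 1) < (r + 1 + e).choose (e + 1) := by
    intro r
    rw [show r + 1 + e = r + e + 1 by omega, Nat.choose_succ_succ' (r + e) e]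
    have : 0 < (r + e).choose e := Nat.choose_pos (by omega)
    omega
  have hge : ∀ r, r ≤ (r + e).choose (e + 1) :=
    fun _ => (strictMono_nat_of_lt_succ hstep).le_apply
  have h1 : (0 + 1 + e).choose (e + 1) ≤ n := by
    rw [show 0 + 1 + e = e + 1 by omega, Nat.choose_self]
    exact hn
  refine ⟨Nat.findGreatest (fun r => (r + 1 + e).choose (e + 1) ≤ n) n,
    Nat.findGreatest_spec (P := fun r => (r + 1 + e).choose (e + 1) ≤ n) (Nat.zero_le n) h1, ?_⟩
  by_contra! h
  set g := Nat.findGreatest (fun r => (r + 1 + e).choose (e + 1) ≤ n) n with hg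
  have h2 : g + 1 ≤ n := by
    have := hge (g + 2)
    omega
  have := Nat.le_findGreatest (P := fun r => (r + 1 + e).choose (e + 1) ≤ n) h2
    (by rw [show g + 1 + 1 + e = g + 2 + e by omega]; exact h)
  omega

/-- The scale `v = (d! n)^(1/d)`. -/
lemma exists_scale {d n : ℕ} (hd : 1 ≤ d) (hn : 1 ≤ n) :
    ∃ v : ℝ, 1 ≤ v ∧ v ^ d = (d.factorial : ℝ) * n ∧
      lam d * (n : ℝ) ^ (1 - 1 / (d : ℝ)) = d * n / v ∧
      (d : ℝ) / v ≤ Real.exp 1 * (n : ℝ) ^ (-(1 / (d : ℝ))) := by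
  have hd0 : (0 : ℝ) < d := by exact_mod_cast hd
  have hn0 : (0 : ℝ) < n := by exact_mod_cast hn
  have hn1 : (1 : ℝ) ≤ n := by exact_mod_cast hn
  have hf1 : (1 : ℝ) ≤ d.factorial := by exact_mod_cast Nat.factorial_pos d
  have hF : ((d.factorial : ℝ) ^ (1 / (d : ℝ))) ^ d = d.factorial := by
    rw [one_div]
    exact Real.rpow_inv_natCast_pow (by positivity) (by omega)
  have hY : ((n : ℝ) ^ (1 / (d : ℝ))) ^ d = n := by
    rw [one_div]
    exact Real.rpow_inv_natCast_pow (by positivity) (by omega)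
  have hF1 : 1 ≤ (d.factorial : ℝ) ^ (1 / (d : ℝ)) := Real.one_le_rpow hf1 (by positivity)
  have hY1 : 1 ≤ (n : ℝ) ^ (1 / (d : ℝ)) := Real.one_le_rpow hn1 (by positivity)
  rw [lam, Real.rpow_neg hn0.le, Real.rpow_sub hn0, Real.rpow_one]
  set F := (d.factorial : ℝ) ^ (1 / (d : ℝ))
  set Y := (n : ℝ) ^ (1 / (d : ℝ))
  have hFe : (d : ℝ) ≤ Real.exp 1 * F := by
    refine le_of_pow_le_pow_left₀ (n := d) (by omega) (by positivity) ?_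
    rw [mul_pow, hF, ← Real.exp_nat_mul, mul_one]
    have := Real.pow_div_factorial_le_exp (d : ℝ) hd0.le d
    rwa [div_le_iff₀ (by positivity)] at this
  refine ⟨F * Y, one_le_mul_of_one_le_of_one_le hF1 hY1, by rw [mul_pow, hF, hY], ?_, ?_⟩
  · field_simp
  · rw [div_le_iff₀ (by positivity)]
    calc (d : ℝ) ≤ Real.exp 1 * F := hFe
      _ = _ := by field_simp

/-- Both bounds compare `d! n` with rising factorials: the least factor gives the lower bound, the
mean of the factors the upper one. -/
lemma scale_bounds {e r n : ℕ} {v : ℝ} (hv : 0 < v)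
    (hvn : v ^ (e + 1) = ((e + 1).factorial : ℝ) * n)
    (hlow : (r + 1 + e).choose (e + 1) ≤ n) (hup : n < (r + 2 + e).choose (e + 1)) :
    (r : ℝ) + 1 ≤ v ∧ v < (r : ℝ) + 1 + ((e : ℝ) + 2) / 2 := by
  have hf : (0 : ℝ) < ((e + 1).factorial : ℝ) := by exact_mod_cast Nat.factorial_pos _
  constructor
  · refine le_of_pow_le_pow_left₀ (n := e + 1) (Nat.succ_ne_zero e) hv.le ?_
    rw [hvn]
    have h1 : (r + 1) ^ (e + 1) ≤ (e + 1).factorial * n := by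
      refine (Nat.pow_succ_le_ascFactorial (r + 1) (e + 1)).trans ?_
      rw [Nat.ascFactorial_eq_factorial_mul_choose]
      exact Nat.mul_le_mul_left _ (by rwa [show r + (e + 1) = r + 1 + e by omega])
    exact_mod_cast h1
  · refine lt_of_pow_lt_pow_left₀ (e + 1) (by positivity) ?_
    have h1 := ascFactorial_le_mean_pow (r + 1) (e + 1)
    rw [Nat.ascFactorial_eq_factorial_mul_choose, show r + 1 + (e + 1) = r + 2 + e by omega] at h1
    push_cast at h1
    rw [hvn]
    have h2 : (n : ℝ) < ((r + 2 + e).choose (e + 1) : ℝ) := by exact_mod_cast hup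
    have h3 : (r : ℝ) + 1 + ((e : ℝ) + 2) / 2 = r + 1 + (e + 1 + 1) / 2 := by ring
    rw [h3]
    refine lt_of_lt_of_le ?_ h1
    gcongr

lemma choose_two_le {r e : ℕ} (he : 2 ≤ e) : (r + 2).choose 2 ≤ (r + e).choose e := by
  rw [← Nat.choose_symm_add, ← Nat.choose_symm_add]
  exact Nat.choose_le_choose r (by omega)

lemma cast_choose_two_le {r e : ℕ} (he : 2 ≤ e) :
    ((r : ℝ) + 1) * (r + 2) / 2 ≤ ((r + e).choose e : ℝ) := by
  have h : (((r + 2).choose 2 : ℕ) : ℝ) ≤ ((r + e).choose e : ℝ) := by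
    exact_mod_cast choose_two_le he
  rw [Nat.cast_choose_two] at h
  push_cast at h
  linarith

/-- The ratio of the two sides of the main lower bound, in the range `R ≤ 3 d`. -/
lemma ratio_le_of_le {d R v : ℝ} (hd : 0 < d) (h : 1 ≤ R + d) (hR : d / 2 ≤ R)
    (hR3 : R ≤ 3 * d) (hv : d ≤ v) :
    (v - d) ^ 2 * ((R + d - 1) * (R + d)) ≤ 64 / 81 * (R * v ^ 3) := by
  -- `(v-d)²/v³` is largest at `v = 3d`. With `3 (R+d)² ≤ 16 R d`, which follows from `(3R-d)(3d-R)
  -- ≥ 0`, the constant is `(4/27)(16/3) = 64/81`.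
  have h1 : 27 * d * (v - d) ^ 2 ≤ 4 * v ^ 3 := by
    have : 0 ≤ (v - 3 * d) ^ 2 * (4 * v - 3 * d) := mul_nonneg (sq_nonneg _) (by linarith)
    linarith
  have h2 : 3 * ((R + d - 1) * (R + d)) ≤ 16 * (R * d) := by
    nlinarith [mul_nonneg (show 0 ≤ 3 * R - d by linarith) (show 0 ≤ 3 * d - R by linarith)]
  have h3 : 0 ≤ (R + d - 1) * (R + d) := mul_nonneg (by linarith) (by linarith)
  have hv0 : 0 ≤ 4 * v ^ 3 := by
    have : 0 < v := by linarith
    positivity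
  have h4 := mul_le_mul h1 h2 (by linarith) hv0
  have h5 : 81 * d * ((v - d) ^ 2 * ((R + d - 1) * (R + d))) ≤ 81 * d * (64 / 81 * (R * v ^ 3)) := by
    linarith
  exact le_of_mul_le_mul_left h5 (by linarith)

/-- The same ratio in the range `3 d ≤ R`. -/
lemma ratio_le_of_ge {d R v : ℝ} (hd : 1 ≤ d) (hR3 : 3 * d ≤ R) (hv : R ≤ v) :
    (v - d) ^ 2 * ((R + d - 1) * (R + d)) ≤ (1 - d ^ 2 / R ^ 2) * (R * v ^ 3) := by
  have hR0 : 0 < R := by linarith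
  have hv0 : 0 < v := by linarith
  have h1 : (v - d) ^ 2 * R ^ 3 ≤ (R - d) ^ 2 * v ^ 3 := by
    obtain ⟨x, rfl⟩ : ∃ x, v = R + x := ⟨v - R, by ring⟩
    have hx : 0 ≤ x := by linarith
    have h2 : 0 ≤ 3 * (R - d) ^ 2 - R ^ 2 := by nlinarith
    have h3 : (R - d) ^ 2 * (R + x) ^ 3 - (R + x - d) ^ 2 * R ^ 3 =
        R ^ 2 * ((R - d) * (R - 3 * d)) * x + R * (3 * (R - d) ^ 2 - R ^ 2) * x ^ 2 +
          (R - d) ^ 2 * x ^ 3 := by ring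
    have h4 : 0 ≤ (R - d) * (R - 3 * d) := mul_nonneg (by linarith) (by linarith)
    have h5 : 0 ≤ (R - d) ^ 2 * (R + x) ^ 3 - (R + x - d) ^ 2 * R ^ 3 := by
      rw [h3]
      positivity
    linarith
  have h2 : (R - d) ^ 2 * ((R + d - 1) * (R + d)) ≤ R ^ 2 * (R ^ 2 - d ^ 2) := by
    have h3 : (R + d - 1) * (R + d) ≤ (R + d) ^ 2 := by nlinarith
    have h4 : 0 ≤ R ^ 2 - d ^ 2 := by nlinarith
    calc _ ≤ (R - d) ^ 2 * (R + d) ^ 2 := by gcongr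
      _ = (R ^ 2 - d ^ 2) * (R ^ 2 - d ^ 2) := by ring
      _ ≤ R ^ 2 * (R ^ 2 - d ^ 2) := by
        refine mul_le_mul_of_nonneg_right ?_ h4
        nlinarith
  have h3 : 0 ≤ (R + d - 1) * (R + d) := mul_nonneg (by linarith) (by linarith)
  have h4 : R ^ 3 * ((v - d) ^ 2 * ((R + d - 1) * (R + d))) ≤
      R ^ 3 * ((1 - d ^ 2 / R ^ 2) * (R * v ^ 3)) := by
    calc _ = ((v - d) ^ 2 * R ^ 3) * ((R + d - 1) * (R + d)) := by ring
      _ ≤ ((R - d) ^ 2 * v ^ 3) * ((R + d - 1) * (R + d)) := by gcongr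
      _ = ((R - d) ^ 2 * ((R + d - 1) * (R + d))) * v ^ 3 := by ring
      _ ≤ (R ^ 2 * (R ^ 2 - d ^ 2)) * v ^ 3 := by gcongr
      _ = _ := by field_simp
  exact le_of_mul_le_mul_left h4 (by positivity)

lemma layer_lower_bound {e r n : ℕ} (hup : n < (r + 2 + e).choose (e + 1)) :
    ((e : ℝ) + 1) * (r + 1) * n ≤
      ((r + e).choose e : ℝ) * ((r + e + 1) * (r + e + 2)) := by
  have h1 : (((r + e).choose e * ((r + e + 1) * (r + e + 2)) : ℕ) : ℝ) =
      (((e + 1) * (r + 1) * (r + 2 + e).choose (e + 1) : ℕ) : ℝ) := by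
    rw [choose_two_layers]
  push_cast at h1
  rw [h1]
  have h2 : (n : ℝ) ≤ ((r + 2 + e).choose (e + 1) : ℝ) := by exact_mod_cast hup.le
  gcongr

lemma mul_le_layer_sub_one {e r n : ℕ} (he : 1 ≤ e) {v : ℝ}
    (hvn : v ^ (e + 1) = ((e + 1).factorial : ℝ) * n) (hn : 1 ≤ n)
    (hlow : (r + 1 + e).choose (e + 1) ≤ n) (hup : n < (r + 2 + e).choose (e + 1))
    (hv : (e : ℝ) + 2 ≤ v) :
    (1 - ((e : ℝ) + 1) / v) ^ 2 * (((e : ℝ) + 1) * n / v) ≤ ((r + e).choose e : ℝ) - 1 := by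
  have he1 : (1 : ℝ) ≤ e := by exact_mod_cast he
  have hv0 : 0 < v := by linarith
  obtain ⟨hb1, hb2⟩ := scale_bounds hv0 hvn hlow hup
  have hn0 : (0 : ℝ) < n := by exact_mod_cast hn
  -- In the plane the layer has only `r + 1` points, too few for the quadratic bound used below, so
  -- this case is computed directly.
  rcases Nat.lt_or_ge e 2 with h2 | h2
  · obtain rfl : e = 1 := by omega
    norm_num at hvn hb2 hv ⊢
    have h3 : 2 * (n : ℝ) / v = v := by
      rw [← hvn]
      field_simp
    rw [h3]
    have h4 : (1 - 2 / v) ^ 2 * v = (v - 2) ^ 2 / v := by field_simp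
    rw [h4, div_le_iff₀ hv0]
    nlinarith
  have he2 : (2 : ℝ) ≤ e := by exact_mod_cast h2
  have hM := cast_choose_two_le (r := r) h2
  have hlayer := layer_lower_bound hup
  set M : ℝ := ((r + e).choose e : ℝ) with hMdef
  set d : ℝ := (e : ℝ) + 1 with hd
  set R : ℝ := (r : ℝ) + 1 with hR
  have hRd : d / 2 ≤ R := by linarith
  have hprod : ((r : ℝ) + e + 1) * (r + e + 2) = (R + d - 1) * (R + d) := by
    rw [hd, hR]
    ring
  rw [hprod] at hlayer
  have hR0 : 0 < R := by positivity
  have hK : 0 < (R + d - 1) * (R + d) := mul_pos (by linarith) (by linarith)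
  -- The factor `φ` must leave room for the lost vertex: `(1 - φ) M ≥ 1`.
  have hmain : ∀ φ : ℝ, 0 ≤ φ → (v - d) ^ 2 * ((R + d - 1) * (R + d)) ≤ φ * (R * v ^ 3) →
      (1 - d / v) ^ 2 * (d * n / v) ≤ φ * M := by
    intro φ hφ0 hφ
    have h1 : (1 - d / v) ^ 2 * (d * n / v) = (v - d) ^ 2 * (d * n) / v ^ 3 := by
      field_simp
    rw [h1, div_le_iff₀ (by positivity)]
    have h3 : (R * ((R + d - 1) * (R + d))) * ((v - d) ^ 2 * (d * n)) ≤
        (R * ((R + d - 1) * (R + d))) * (φ * M * v ^ 3) := by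
      calc _ = ((v - d) ^ 2 * ((R + d - 1) * (R + d))) * (d * R * n) := by ring
        _ ≤ (φ * (R * v ^ 3)) * (M * ((R + d - 1) * (R + d))) := by gcongr
        _ = _ := by ring
    exact le_of_mul_le_mul_left h3 (by positivity)
  have hr2 : 2 ≤ r := by
    have h3 : (1 : ℝ) < r := by linarith
    have h4 : 1 < r := by exact_mod_cast h3
    omega
  have hr2' : (2 : ℝ) ≤ r := by exact_mod_cast hr2
  rcases le_total R (3 * d) with h3 | h3
  · have h4 := ratio_le_of_le (by linarith) (by linarith) hRd h3 (by linarith : d ≤ v)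
    have h5 := hmain _ (by norm_num) h4
    have h6 : (6 : ℝ) ≤ M := by nlinarith
    linarith
  · have hle : d ^ 2 / R ^ 2 ≤ 1 := by
      rw [div_le_one (by positivity)]
      exact pow_le_pow_left₀ (by linarith) (by linarith) 2
    have h5 := hmain _ (by linarith) (ratio_le_of_ge (by linarith) h3 hb1)
    have h6 : 1 ≤ d ^ 2 / R ^ 2 * M := by
      rw [div_mul_eq_mul_div, le_div_iff₀ (by positivity), one_mul]
      have h7 : R * (R + 1) / 2 ≤ M := by
        refine le_trans (le_of_eq ?_) hM
        rw [hR]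
        ring
      have h8 : R ^ 2 / 2 ≤ M := by nlinarith
      have h9 : 9 ≤ d ^ 2 := by nlinarith
      nlinarith
    linarith

lemma crude_le_layer_sub_one {e r n : ℕ} (he : 1 ≤ e) (hr : 1 ≤ r) {v : ℝ} (hv0 : 0 < v)
    (hvn : v ^ (e + 1) = ((e + 1).factorial : ℝ) * n)
    (hlow : (r + 1 + e).choose (e + 1) ≤ n) (hup : n < (r + 2 + e).choose (e + 1)) :
    (1 / ((e : ℝ) + 2)) ^ 2 * (((e : ℝ) + 1) * n / v) ≤ ((r + e).choose e : ℝ) - 1 := by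
  have he1 : (1 : ℝ) ≤ e := by exact_mod_cast he
  have hr1 : (1 : ℝ) ≤ r := by exact_mod_cast hr
  obtain ⟨hb1, -⟩ := scale_bounds hv0 hvn hlow hup
  have hlayer := layer_lower_bound hup
  have hM : (2 : ℝ) ≤ ((r + e).choose e : ℝ) := by
    have h1 : (1 + e).choose e ≤ (r + e).choose e := Nat.choose_le_choose e (by omega)
    rw [Nat.add_comm 1 e, Nat.choose_succ_self_right] at h1
    exact_mod_cast (by omega : 2 ≤ (r + e).choose e)
  set M : ℝ := ((r + e).choose e : ℝ) with hMdef
  have h1 : (1 / ((e : ℝ) + 2)) ^ 2 * (((e : ℝ) + 1) * n / v) ≤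
      (1 / ((e : ℝ) + 2)) ^ 2 * (((e : ℝ) + 1) * n / (r + 1)) := by gcongr
  refine h1.trans ((?_ : _ ≤ M / 2).trans (by linarith))
  have h2 : (1 / ((e : ℝ) + 2)) ^ 2 * (((e : ℝ) + 1) * n / (r + 1)) =
      ((e : ℝ) + 1) * (r + 1) * n / ((e + 2) ^ 2 * (r + 1) ^ 2) := by
    field_simp
  rw [h2, div_le_iff₀ (by positivity)]
  refine hlayer.trans ?_
  have h3 : 2 * (((r : ℝ) + e + 1) * (r + e + 2)) ≤ (e + 2) ^ 2 * (r + 1) ^ 2 := by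
    obtain ⟨x, hx⟩ : ∃ x : ℝ, (r : ℝ) = 1 + x := ⟨r - 1, by ring⟩
    obtain ⟨z, hz⟩ : ∃ z : ℝ, (e : ℝ) = 1 + z := ⟨e - 1, by ring⟩
    have hx0 : 0 ≤ x := by linarith
    have hz0 : 0 ≤ z := by linarith
    rw [hx, hz]
    have h4 : (1 + z + 2) ^ 2 * (1 + x + 1) ^ 2 -
        2 * ((1 + x + (1 + z) + 1) * (1 + x + (1 + z) + 2)) =
        12 + 22 * x + 10 * z + 7 * x ^ 2 + 2 * z ^ 2 + 20 * x * z + 6 * x ^ 2 * z + 4 * x * z ^ 2 +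
          x ^ 2 * z ^ 2 := by ring
    have h5 : 0 ≤ (1 + z + 2) ^ 2 * (1 + x + 1) ^ 2 -
        2 * ((1 + x + (1 + z) + 1) * (1 + x + (1 + z) + 2)) := by
      rw [h4]
      positivity
    linarith
  have h4 := mul_le_mul_of_nonneg_left h3 (show 0 ≤ M by linarith)
  linarith

lemma log_two_mul_le_log_p {e r n : ℕ} (hlow : (r + 1 + e).choose (e + 1) ≤ n) :
    (((r + e).choose e : ℝ) - 1) * Real.log 2 ≤ Real.log (p (e + 1) n) := by
  have h1 := two_pow_le_p hlow
  have hM : 1 ≤ (r + e).choose e := Nat.choose_pos (by omega)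
  have h2 : ((2 : ℝ) ^ ((r + e).choose e - 1)) ≤ (p (e + 1) n : ℝ) := by exact_mod_cast h1
  have h3 := Real.log_le_log (by positivity) h2
  rw [Real.log_pow, Nat.cast_sub hM, Nat.cast_one] at h3
  exact h3

lemma lowerConst_le_growth {d n : ℕ} (hd : 2 ≤ d) (hn : 2 ≤ n) : lowerConst d n ≤ growth d n := by
  obtain ⟨e, rfl⟩ : ∃ e, d = e + 1 := ⟨d - 1, by omega⟩
  have he : 1 ≤ e := by omega
  have hlog2 : 0 < Real.log 2 := Real.log_pos (by norm_num)
  obtain ⟨v, hv1, hvn, hlam, hexp⟩ := exists_scale (d := e + 1) (n := n) (by omega) (by omega)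
  have hv0 : 0 < v := by linarith
  have hn0 : (0 : ℝ) < n := by exact_mod_cast (by omega : 0 < n)
  obtain ⟨r, hlow, hup⟩ := exists_choose_le_lt e n (by omega)
  rw [growth, le_div_iff₀ (Real.rpow_pos_of_pos hn0 _), lowerConst]
  set ε := Real.exp 1 * (n : ℝ) ^ (-(1 / ((e + 1 : ℕ) : ℝ))) with hε
  have hcalc : ∀ x : ℝ, x * lam (e + 1) * Real.log 2 * (n : ℝ) ^ (1 - 1 / ((e + 1 : ℕ) : ℝ)) =
      x * (((e : ℝ) + 1) * n / v) * Real.log 2 := by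
    intro x
    push_cast at hlam ⊢
    rw [← hlam]
    ring
  rw [hcalc]
  push_cast at hexp ⊢
  rcases le_total ((e + 1 : ℝ) / (e + 1 + 1)) ε with h | h
  · rw [min_eq_left h]
    have h1 : 1 - ((e : ℝ) + 1) / (e + 1 + 1) = 1 / (e + 2) := by
      field_simp
      ring
    rw [h1]
    -- For `r = 0` the layer bound is void, but then `n ≤ d` and two lower sets are enough.
    rcases Nat.eq_zero_or_pos r with rfl | hr
    · have h2 : (2 : ℝ) ≤ p (e + 1) n := by exact_mod_cast two_le_p he hn
      have h3 := Real.log_le_log (by norm_num) h2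
      refine le_trans ?_ h3
      refine mul_le_of_le_one_left hlog2.le ?_
      have h4 : n ≤ e + 1 := by
        rw [show 0 + 2 + e = e + 1 + 1 by omega, Nat.choose_succ_self_right] at hup
        omega
      have h5 : (n : ℝ) ≤ e + 1 := by exact_mod_cast h4
      rw [div_pow, one_pow, div_mul_div_comm, one_mul, div_le_one (by positivity)]
      have h6 : ((e : ℝ) + 1) * n ≤ (e + 1) * (e + 1) := by gcongr
      nlinarith [sq_nonneg ((e : ℝ) + 2)]
    · exact (mul_le_mul_of_nonneg_right (crude_le_layer_sub_one he hr hv0 hvn hlow hup)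
        hlog2.le).trans (log_two_mul_le_log_p hlow)
  · rw [min_eq_right h]
    -- This branch of the minimum forces `v ≥ d + 1`, as the sharp comparison requires.
    have h1 : ((e : ℝ) + 1) / v ≤ (e + 1) / (e + 1 + 1) := hexp.trans h
    have h2 : (e : ℝ) + 2 ≤ v := by
      rw [div_le_div_iff₀ hv0 (by positivity)] at h1
      have := le_of_mul_le_mul_left h1 (by positivity)
      linarith
    refine le_trans ?_ ((mul_le_mul_of_nonneg_right
      (mul_le_layer_sub_one he hvn (by omega) hlow hup h2) hlog2.le).trans
        (log_two_mul_le_log_p hlow))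
    have h3 : ε ≤ 1 := h.trans (by rw [div_le_one (by positivity)]; linarith)
    have h4 : 0 ≤ 1 - ε := by linarith
    gcongr

/-! ### The strict lower growth rate -/

lemma tendsto_layer_ratio (e : ℕ) (he : 1 ≤ e) (c f : ℝ) :
    Tendsto (fun r : ℕ => (((r : ℝ) + 1) ^ e - f) / ((r : ℝ) + c) ^ e) atTop (nhds 1) := by
  have h0 : Tendsto (fun r : ℕ => (r : ℝ) + c) atTop atTop :=
    tendsto_atTop_add_const_right _ _ tendsto_natCast_atTop_atTop
  have h1 : Tendsto (fun r : ℕ => ((r : ℝ) + c)⁻¹) atTop (nhds 0) := tendsto_inv_atTop_zero.comp h0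
  have h2 : Tendsto (fun r : ℕ => (1 - (c - 1) * ((r : ℝ) + c)⁻¹) ^ e - f * ((r : ℝ) + c)⁻¹ ^ e)
      atTop (nhds 1) := by
    have := ((tendsto_const_nhds (x := (1 : ℝ))).sub (h1.const_mul (c - 1))).pow e |>.sub
      ((h1.pow e).const_mul f)
    simpa [zero_pow (show e ≠ 0 by omega)] using this
  refine h2.congr' ?_
  filter_upwards [h0.eventually_gt_atTop 0] with r hr
  have h3 : 1 - (c - 1) * ((r : ℝ) + c)⁻¹ = ((r : ℝ) + 1) / (r + c) := by
    field_simp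
    ring
  rw [h3, div_pow, sub_div, inv_pow, div_eq_mul_inv f]

/-- The lower growth rate exceeds `λ_d log 2` by a fixed factor. -/
lemma eventually_le_growth {d : ℕ} (hd : 2 ≤ d) :
    ∀ᶠ n in atTop, (1 + 1 / 2 ^ (d + 1)) * (lam d * Real.log 2) ≤ growth d n := by
  obtain ⟨e, rfl⟩ : ∃ e, d = e + 1 := ⟨d - 1, by omega⟩
  have he : 1 ≤ e := by omega
  have hlog2 : 0 < Real.log 2 := Real.log_pos (by norm_num)
  set q : ℝ := 1 / 2 ^ (e + 1) with hq
  have hq0 : 0 < q := by positivity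
  have hq2 : (1 : ℝ) / 2 ^ (e + 1 + 1) = q / 2 := by
    rw [hq, pow_succ _ (e + 1)]
    field_simp
  rw [hq2]
  -- Two layers give the factor `1 + q` asymptotically; claiming only `1 + q/2` absorbs the ratio
  -- tending to `1`.
  have hratio : (1 + q / 2) / (1 + q) < 1 := by
    rw [div_lt_one (by positivity)]
    linarith
  obtain ⟨r₀, hr₀⟩ := eventually_atTop.1 ((tendsto_layer_ratio e he (2 + ((e : ℝ) + 2) / 2)
    (e.factorial : ℝ)).eventually_const_lt hratio)
  filter_upwards [eventually_ge_atTop ((r₀ + 3 + e).choose (e + 1)), eventually_ge_atTop 2]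
    with n hn hn2
  obtain ⟨s, hlow, hup⟩ := exists_choose_le_lt e n (by omega)
  have hs : r₀ + 1 ≤ s := by
    by_contra! h
    have := Nat.choose_le_choose (e + 1) (show s + 2 + e ≤ r₀ + 3 + e by omega)
    omega
  -- The second free layer must still fit within `n` points, so the free layers are `s - 1` and `s`.
  obtain ⟨r, rfl⟩ : ∃ r, s = r + 1 := ⟨s - 1, by omega⟩
  have hr := hr₀ r (by omega)
  obtain ⟨v, hv1, hvn, hlam, -⟩ := exists_scale (d := e + 1) (n := n) (by omega) (by omega)
  have hv0 : 0 < v := by linarith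
  obtain ⟨-, hvup⟩ := scale_bounds hv0 hvn hlow hup
  have hn0 : (0 : ℝ) < n := by exact_mod_cast (by omega : 0 < n)
  have hp := two_rpow_le_p (e := e) (r := r) (n := n)
    (by rwa [show r + 2 + e = r + 1 + 1 + e by omega])
  have hlogp := Real.log_le_log (by positivity) hp
  rw [Real.log_rpow (by norm_num)] at hlogp
  rw [growth, le_div_iff₀ (Real.rpow_pos_of_pos hn0 _)]
  have hL : (1 + q / 2) * (lam (e + 1) * Real.log 2) * (n : ℝ) ^ (1 - 1 / ((e + 1 : ℕ) : ℝ)) =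
      (1 + q / 2) * (((e + 1 : ℕ) : ℝ) * n / v) * Real.log 2 := by
    rw [← hlam]
    ring
  rw [hL]
  refine le_trans (mul_le_mul_of_nonneg_right ?_ hlog2.le) hlogp
  have hf : (0 : ℝ) < e.factorial := by exact_mod_cast Nat.factorial_pos e
  have hdn : ((e + 1 : ℕ) : ℝ) * n / v = v ^ e / e.factorial := by
    rw [Nat.factorial_succ] at hvn
    push_cast at hvn ⊢
    rw [div_eq_div_iff hv0.ne' hf.ne', ← pow_succ, hvn]
    ring
  have hM : ((r : ℝ) + 1) ^ e / e.factorial ≤ ((r + e).choose e : ℝ) := by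
    have := Nat.pow_le_choose (α := ℝ) e (r + e)
    rw [show r + e + 1 - e = r + 1 by omega] at this
    exact_mod_cast this
  have hMM : ((r + e).choose e : ℝ) ≤ ((r + 1 + e).choose e : ℝ) := by
    exact_mod_cast Nat.choose_le_choose e (by omega)
  set M : ℝ := ((r + e).choose e : ℝ)
  set M' : ℝ := ((r + 1 + e).choose e : ℝ)
  have h1 : (1 + q) * (M - 1) ≤ M - 1 + (M' - 1) / 2 ^ (e + 1) := by
    have h2 : (M' - 1) / 2 ^ (e + 1) = q * (M' - 1) := by
      rw [hq]
      ring
    have h3 : q * (M - 1) ≤ q * (M' - 1) := mul_le_mul_of_nonneg_left (by linarith) hq0.le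
    rw [h2]
    linarith
  refine le_trans ?_ h1
  rw [hdn]
  set c : ℝ := 2 + ((e : ℝ) + 2) / 2 with hc
  have hrc : 0 < (r : ℝ) + c := by positivity
  have hvc : v ^ e ≤ ((r : ℝ) + c) ^ e := by
    refine pow_le_pow_left₀ hv0.le ?_ e
    push_cast at hvup
    rw [hc]
    linarith
  rw [div_lt_div_iff₀ (by positivity) (by positivity)] at hr
  have h4 : (1 + q) * (((r : ℝ) + 1) ^ e / e.factorial - 1) ≤ (1 + q) * (M - 1) := by
    gcongr
  refine le_trans ?_ h4
  have h5 : (1 + q) * (((r : ℝ) + 1) ^ e / e.factorial - 1) =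
      ((((r : ℝ) + 1) ^ e - e.factorial) * (1 + q)) / e.factorial := by
    field_simp
  rw [h5, ← mul_div_assoc]
  refine div_le_div_of_nonneg_right (le_trans ?_ hr.le) hf.le
  gcongr

lemma lam_pos {d : ℕ} (hd : 1 ≤ d) : 0 < lam d := by
  have : (0 : ℝ) < d := by exact_mod_cast hd
  have : (0 : ℝ) < d.factorial := by exact_mod_cast Nat.factorial_pos d
  unfold lam
  positivity

lemma lam_mul_log_two_lt_alphaInf {d : ℕ} (hd : 2 ≤ d) :
    ((lam d * Real.log 2 : ℝ) : EReal) < alphaInf d := by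
  have hpos : 0 < lam d * Real.log 2 :=
    mul_pos (lam_pos (by omega)) (Real.log_pos (by norm_num))
  have h1 : ((lam d * Real.log 2 : ℝ) : EReal) <
      (((1 + 1 / 2 ^ (d + 1)) * (lam d * Real.log 2) : ℝ) : EReal) := by
    rw [EReal.coe_lt_coe_iff]
    refine lt_mul_of_one_lt_left hpos ?_
    have : (0 : ℝ) < 1 / 2 ^ (d + 1) := by positivity
    linarith
  refine h1.trans_le (le_liminf_of_le (by isBoundedDefault) ?_)
  filter_upwards [eventually_le_growth hd] with n hn
  exact EReal.coe_le_coe_iff.2 hn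

/-! ### Consequences of the upper bound -/

lemma p_pos {d n : ℕ} (hd : 1 ≤ d) : 0 < p d n := by
  obtain ⟨e, rfl⟩ : ∃ e, d = e + 1 := ⟨d - 1, by omega⟩
  rcases Nat.eq_zero_or_pos n with rfl | hn
  · rw [p_zero_right]
    exact one_pos
  · obtain ⟨r, hlow, -⟩ := exists_choose_le_lt e n hn
    exact (pow_pos two_pos _).trans_le (two_pow_le_p hlow)

lemma growth_le_of_growthBound {d n : ℕ} (hd : 1 ≤ d) (hn : 1 ≤ n) {C : ℝ}
    (hb : GrowthBound d C) : growth d n ≤ C := by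
  have hn0 : (0 : ℝ) < n := by exact_mod_cast hn
  rw [growth, div_le_iff₀ (Real.rpow_pos_of_pos hn0 _),
    Real.log_le_iff_le_exp (by exact_mod_cast p_pos hd)]
  exact hb n

lemma p_le_gam_rpow {d : ℕ} (hd : 2 ≤ d) (n : ℕ) :
    (p d n : ℝ) ≤ gam d ^ ((n : ℝ) ^ (1 - 1 / (d : ℝ))) := by
  obtain ⟨C, -, hlt, hb⟩ := exists_growthBound_lt hd
  rw [gam, ← Real.exp_mul]
  refine (hb n).trans (Real.exp_le_exp.2 ?_)
  have : 0 ≤ (n : ℝ) ^ (1 - 1 / (d : ℝ)) := by positivity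
  exact mul_le_mul_of_nonneg_right hlt.le this

lemma alphaSup_lt {d : ℕ} (hd : 2 ≤ d) : alphaSup d < ((upperConst d : ℝ) : EReal) := by
  obtain ⟨C, -, hlt, hb⟩ := exists_growthBound_lt hd
  refine lt_of_le_of_lt (limsup_le_of_le (a := ((C : ℝ) : EReal)) (by isBoundedDefault) ?_)
    (EReal.coe_lt_coe_iff.2 hlt)
  filter_upwards [eventually_ge_atTop 1] with n hn
  exact EReal.coe_le_coe_iff.2 (growth_le_of_growthBound (by omega) hn hb)

/-! ### The conjectured value in dimensions at least eight -/

lemma zeta_re_eq_tsum {d : ℕ} (hd : 1 < d) :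
    (riemannZeta (d : ℂ)).re = ∑' n : ℕ, 1 / (n : ℝ) ^ d := by
  rw [zeta_nat_eq_tsum_of_gt_one hd]
  have h : ∀ n : ℕ, (1 / (n : ℂ) ^ d) = ((1 / (n : ℝ) ^ d : ℝ) : ℂ) := fun n => by push_cast; rfl
  simp_rw [h]
  rw [← Complex.ofReal_tsum, Complex.ofReal_re]

lemma zeta_re_le {d : ℕ} (hd : 8 ≤ d) : (riemannZeta (d : ℂ)).re ≤ 1.02 := by
  have hs : Summable fun n : ℕ => 1 / (n : ℝ) ^ d := Real.summable_one_div_nat_pow.2 (by omega)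
  have hs2 := hasSum_zeta_two
  -- The term at `0` is `1/0 = 0` and the term at `1` is `1`; the rest is at most `(π²/6 - 1)/64`,
  -- since `n^(d-2) ≥ 64` for `n ≥ 2`.
  rw [zeta_re_eq_tsum (by omega), ← hs.sum_add_tsum_nat_add 2]
  have hz2 := (hasSum_nat_add_iff' 2).2 hs2
  have hle : ∀ n : ℕ, 1 / ((n + 2 : ℕ) : ℝ) ^ d ≤ 1 / 64 * (1 / ((n + 2 : ℕ) : ℝ) ^ 2) := by
    intro n
    have h2 : (2 : ℝ) ≤ ((n + 2 : ℕ) : ℝ) := by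
      push_cast
      linarith [Nat.cast_nonneg (α := ℝ) n]
    have h3 : (64 : ℝ) ≤ ((n + 2 : ℕ) : ℝ) ^ (d - 2) := by
      calc (64 : ℝ) = 2 ^ 6 := by norm_num
        _ ≤ 2 ^ (d - 2) := pow_le_pow_right₀ (by norm_num) (by omega)
        _ ≤ _ := pow_le_pow_left₀ (by norm_num) h2 _
    rw [one_div_mul_one_div]
    refine one_div_le_one_div_of_le (by positivity) ?_
    calc (64 : ℝ) * ((n + 2 : ℕ) : ℝ) ^ 2 ≤ ((n + 2 : ℕ) : ℝ) ^ (d - 2) * ((n + 2 : ℕ) : ℝ) ^ 2 := by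
          gcongr
      _ = _ := by rw [← pow_add, Nat.sub_add_cancel (by omega)]
  have h1 := hasSum_le hle ((summable_nat_add_iff 2).2 hs).hasSum (hz2.mul_left (1 / 64))
  refine (add_le_add_right h1 _).trans ?_
  simp [Finset.sum_range_succ, show d ≠ 0 by omega]
  nlinarith [Real.pi_lt_d2, Real.pi_pos]

/-- The `d`-th power of `ρ_d ≤ λ_d ln 2`, with `1.02` in place of `ζ(d)`. It fails at `d = 7`. From
`d` to `d + 1` the left side gains `d (d+1)/(d-1)` and the right side at least `2 d ln 2`, because
`(d/(d-1))^d ≥ 2`. -/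
lemma factorial_mul_le {d : ℕ} (hd : 8 ≤ d) :
    (d.factorial : ℝ) * (((d : ℝ) - 1) * 1.02) ≤ (((d : ℝ) - 1) * Real.log 2) ^ d := by
  have hl : 0.6931 ≤ Real.log 2 := by linarith [Real.log_two_gt_d9]
  induction d, hd using Nat.le_induction with
  | base =>
    have h1 : ((8 : ℕ) - 1 : ℝ) * 0.6931 ≤ ((8 : ℕ) - 1 : ℝ) * Real.log 2 := by
      norm_num at hl ⊢
      linarith
    refine le_trans ?_ (pow_le_pow_left₀ (by norm_num) h1 8)
    norm_num [Nat.factorial]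
  | succ d hd ih =>
    have hd8 : (8 : ℝ) ≤ d := by exact_mod_cast hd
    have h1 : (2 : ℝ) * ((d : ℝ) - 1) ^ d ≤ (d : ℝ) ^ d := by
      have hb := one_add_mul_le_pow (a := 1 / ((d : ℝ) - 1))
        (by have : 0 < 1 / ((d : ℝ) - 1) := by
              apply div_pos one_pos
              linarith
            linarith) d
      have h2 : (2 : ℝ) ≤ 1 + d * (1 / ((d : ℝ) - 1)) := by
        have : (1 : ℝ) ≤ d * (1 / ((d : ℝ) - 1)) := by
          rw [mul_one_div, le_div_iff₀ (by linarith)]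
          linarith
        linarith
      have h3 : 1 + 1 / ((d : ℝ) - 1) = d / ((d : ℝ) - 1) := by
        have : (d : ℝ) - 1 ≠ 0 := by linarith
        field_simp
        ring
      rw [h3, div_pow] at hb
      have h4 := h2.trans hb
      rwa [le_div_iff₀ (pow_pos (by linarith) d)] at h4
    rw [Nat.factorial_succ]
    push_cast
    rw [add_sub_cancel_right]
    have hfac : (0 : ℝ) < d.factorial := by exact_mod_cast Nat.factorial_pos d
    have hd1 : (0 : ℝ) < (d : ℝ) - 1 := by linarith
    have hpow : ((d : ℝ) * Real.log 2) ^ (d + 1) =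
        (d : ℝ) ^ d * (Real.log 2) ^ d * (d * Real.log 2) := by
      rw [pow_succ, mul_pow]
    rw [mul_pow] at ih
    rw [hpow]
    have hlp : 0 < Real.log 2 := by linarith
    calc ((d : ℝ) + 1) * d.factorial * (d * 1.02)
        = (d.factorial * ((d - 1) * 1.02)) * (((d : ℝ) + 1) / (d - 1) * d) := by
          field_simp
      _ ≤ ((d - 1) ^ d * Real.log 2 ^ d) * (2 * Real.log 2 * d) := by
          refine mul_le_mul ih ?_ (by positivity) (by positivity)
          refine mul_le_mul_of_nonneg_right ?_ (by linarith)
          rw [div_le_iff₀ hd1]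
          nlinarith
      _ = (2 * ((d : ℝ) - 1) ^ d) * Real.log 2 ^ d * (d * Real.log 2) := by ring
      _ ≤ _ := by gcongr

lemma rho_le_lam_mul_log_two {d : ℕ} (hd : 8 ≤ d) : rho d ≤ lam d * Real.log 2 := by
  have hd8 : (8 : ℝ) ≤ d := by exact_mod_cast hd
  have hfac : (0 : ℝ) < d.factorial := by exact_mod_cast Nat.factorial_pos d
  have hlog2 : 0 < Real.log 2 := Real.log_pos (by norm_num)
  have hd1 : (0 : ℝ) < (d : ℝ) - 1 := by linarith
  have hX : ((d : ℝ) - 1) * (riemannZeta (d : ℂ)).re ≤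
      (((d : ℝ) - 1) * Real.log 2) ^ d / d.factorial := by
    rw [le_div_iff₀ hfac, mul_comm]
    refine le_trans ?_ (factorial_mul_le hd)
    have := zeta_re_le hd
    gcongr
  have hzpos : 0 ≤ (riemannZeta (d : ℂ)).re := by
    rw [zeta_re_eq_tsum (by omega)]
    exact tsum_nonneg fun n => by positivity
  have hroot : (((d : ℝ) - 1) * (riemannZeta (d : ℂ)).re) ^ (1 / (d : ℝ)) ≤
      ((d : ℝ) - 1) * Real.log 2 / (d.factorial : ℝ) ^ (1 / (d : ℝ)) := by
    refine (Real.rpow_le_rpow (by positivity) hX (by positivity)).trans (le_of_eq ?_)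
    rw [Real.div_rpow (by positivity) hfac.le, one_div, Real.pow_rpow_inv_natCast (by positivity)
      (by omega)]
  rw [rho, lam]
  calc _ ≤ (d : ℝ) / ((d : ℝ) - 1) *
        (((d : ℝ) - 1) * Real.log 2 / (d.factorial : ℝ) ^ (1 / (d : ℝ))) := by gcongr
    _ = _ := by
      have : (0 : ℝ) < (d.factorial : ℝ) ^ (1 / (d : ℝ)) := by positivity
      field_simp

lemma rho_lt_alphaInf {d : ℕ} (hd : 8 ≤ d) : ((rho d : ℝ) : EReal) < alphaInf d :=
  (EReal.coe_le_coe_iff.2 (rho_le_lam_mul_log_two hd)).trans_lt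
    (lam_mul_log_two_lt_alphaInf (by omega))

lemma not_tendsto_growth_rho {d : ℕ} (hd : 8 ≤ d) :
    ¬ Tendsto (growth d) atTop (nhds (rho d)) := by
  intro h
  have h1 : Tendsto (fun n => ((growth d n : ℝ) : EReal)) atTop (nhds ((rho d : ℝ) : EReal)) :=
    (continuous_coe_real_ereal.tendsto _).comp h
  exact (rho_lt_alphaInf hd).ne h1.liminf_eq.symm

end LowerSetCount

theorem theorem2 (d : ℕ) (hd : 2 ≤ d) :
    (∀ n : ℕ, 2 ≤ n →
      LowerSetCount.lowerConst d n ≤ LowerSetCount.growth d n ∧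
      LowerSetCount.growth d n ≤ LowerSetCount.upperConst d) ∧
    (∀ n : ℕ,
      (LowerSetCount.p d n : ℝ) ≤ LowerSetCount.gam d ^ ((n : ℝ) ^ (1 - 1 / (d : ℝ)))) ∧
    ((LowerSetCount.lam d * Real.log 2 : ℝ) : EReal) < LowerSetCount.alphaInf d ∧
    LowerSetCount.alphaSup d < ((LowerSetCount.upperConst d : ℝ) : EReal) ∧
    (8 ≤ d →
      ((LowerSetCount.rho d : ℝ) : EReal) < LowerSetCount.alphaInf d ∧
      ¬ Filter.Tendsto (LowerSetCount.growth d) Filter.atTop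
          (nhds (LowerSetCount.rho d))) := by
  refine ⟨fun n hn => ⟨LowerSetCount.lowerConst_le_growth hd hn, ?_⟩,
    LowerSetCount.p_le_gam_rpow hd, LowerSetCount.lam_mul_log_two_lt_alphaInf hd,
    LowerSetCount.alphaSup_lt hd, fun h =>
      ⟨LowerSetCount.rho_lt_alphaInf h, LowerSetCount.not_tendsto_growth_rho h⟩⟩
  obtain ⟨C, -, hlt, hb⟩ := LowerSetCount.exists_growthBound_lt hd
  exact (LowerSetCount.growth_le_of_growthBound (by omega) (by omega) hb).trans hlt.le
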